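/- Let $k$ be a finite field with $q$ elements, $R=k[t]$, and let $k((t^{-1}))$ be the completion of $k(t)$ at the infinite place, $k((t^{-1}))^{\rm sep}$ a separable closure of it, and $G={\rm Gal}(k((t^{-1}))^{\rm sep}/k((t^{-1})))$. Let $E$ be the Carlitz module: for a $k[t]$-algebra $B$, $E(B)$ is the additive group of $B$ with the $k[t]$-module structure in which $t$ acts as $b\mapsto tb+b^q$, while ${\rm Lie}_E(B)=B$ with its usual $k[t]$-module structure. Let $\exp(X)=\sum_{i\ge0} e_iX^{q^i}$ be the Carlitz exponential ($e_0=1$, $\exp(tX)=t\exp(X)+\exp(X)^q$), let $\log(X)=\sum_{i\geq 0} l_iX^{q^i}$ be its inverse power series (the Carlitz logarithm), and let $\Lambda_E$ be the kernel of the surjective $k[t]$-linear map $\exp\colon {\rm Lie}_E(k((t^{-1}))^{\rm sep})\to E(k((t^{-1}))^{\rm sep})$. The connecting homomorphism of the resulting short exact sequence gives a map $E(R)\to E(k((t^{-1})))\to H^1(G,\Lambda_E)$ to (continuous) Galois cohomology; let $H_R$ be the cokernel of $E(R)\to H^1(G,\Lambda_E)$. Write $\exp^{-1}(E(R))$ for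 the $k[t]$-submodule of those $x\in k((t^{-1}))={\rm Lie}_E(k((t^{-1})))$ with $\exp(x)\in R$. For a finite $k[t]$-module $M$ let $|M|\in k[t]$ be the monic generator of the first (i.e. initial) Fitting ideal of $M$, so that $|\bigoplus_i k[t]/(f_i)|=\prod_i f_i$ for monic $f_i$. Put $$\zeta_R(1)=\sum_{0\ne I\subset R}\frac1{|R/I|}\in k((t^{-1})),$$ the sum over the non-zero ideals of $R$. Let ${\rm Reg}_R\in k((t^{-1}))$ be the unique monic (leading coefficient $1$ with respect to $t$) representative, modulo $k[t]^\times$, of the determinant, with respect to $k[t]$-bases of $\exp^{-1}(E(R))$ and ${\rm Lie}_E(R)$, of the $k((t^{-1}))$-linear map $$\rho\colon \exp^{-1}(E(R))\otimes_{k[t]}k((t^{-1}))\to {\rm Lie}_E(R)\otimes_{k[t]}k((t^{-1}))$$ induced by the inclusion of $\exp^{-1}(E(R))$ in ${\rm Lie}_E(k((t^{-1})))$. **Proposition** (class number formula for $R=k[t]$). The series $\log(1)$ converges in $k((t^{-1}))$ and $\exp^{-1}(E(k[t]))$ is generated by $\log(1)$ as a $k[t]$-module; the map $E(k[t])\to H^1(G,\Lambda_E)$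 is surjective; $\rho$ is an isomorphism, ${\rm Reg}_R$ exists and is unique, $H_R$ is finite, the series $\zeta_R(1)$ converges, and $$\zeta_R(1)={\rm Reg}_R\cdot|H_R|.$$ Moreover $\zeta_R(1)=\log(1)$. -/

import Mathlib

open Polynomial
open scoped NNReal WithZero TensorProduct

noncomputable section

namespace Carlitz

section Fields

variable (k : Type*) [Field k]

/-- The field `k((t⁻¹))`, the completion of `k(t)` at the infinite place. -/
abbrev KInfty : Type _ := @RatFunc.CompletionAtInfty k _ (Classical.decEq _)

instance : Algebra k[X] (KInfty k) := Algebra.compHom _ (algebraMap k[X] (RatFunc k))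

instance : Algebra k (KInfty k) := Algebra.compHom _ (algebraMap k (RatFunc k))

instance : IsScalarTower k[X] (RatFunc k) (KInfty k) := IsScalarTower.of_algebraMap_eq fun _ => rfl

instance : IsScalarTower k k[X] (KInfty k) := IsScalarTower.of_algebraMap_eq fun c =>
  congrArg (algebraMap (RatFunc k) (KInfty k)) (IsScalarTower.algebraMap_apply k k[X] (RatFunc k) c)

/-- The element `t` of `k((t⁻¹))`. -/
def tInfty : KInfty k := algebraMap k[X] (KInfty k) X

theorem v_algebraMap (r : RatFunc k) :
    Valued.v (algebraMap (RatFunc k) (KInfty k) r) =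
      @RatFunc.inftyValuation k _ (Classical.decEq _) r :=
  let _ := Classical.decEq (RatFunc k)
  let _ := RatFunc.inftyValued k
  Valued.valuedCompletion_apply r

theorem v_tInfty : Valued.v (tInfty k) = WithZero.exp (1 : ℤ) := by
  letI := Classical.decEq (RatFunc k)
  have h : tInfty k = algebraMap (RatFunc k) (KInfty k) RatFunc.X := by
    rw [tInfty, IsScalarTower.algebraMap_apply k[X] (RatFunc k) (KInfty k), RatFunc.algebraMap_X]
  rw [h, v_algebraMap]
  exact RatFunc.inftyValuation.X k

variable [Fintype k]

theorem one_lt_card_nnreal : (1 : ℝ≥0) < Fintype.card k := by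
  exact_mod_cast Fintype.one_lt_card

theorem card_nnreal_ne_zero : (Fintype.card k : ℝ≥0) ≠ 0 :=
  (zero_lt_one.trans (one_lt_card_nnreal k)).ne'

/-- The absolute value on `k((t⁻¹))` is normalised by `‖t‖ = #k`. -/
instance : (Valued.v : Valuation (KInfty k) ℤᵐ⁰).RankOne where
  hom' := (WithZeroMulInt.toNNReal (card_nnreal_ne_zero k)).comp
    MonoidWithZeroHom.ValueGroup₀.embedding
  strictMono' := (WithZeroMulInt.toNNReal_strictMono (one_lt_card_nnreal k)).comp
    MonoidWithZeroHom.ValueGroup₀.embedding_strictMono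
  exists_val_nontrivial := ⟨tInfty k, by rw [v_tInfty]; simp, by rw [v_tInfty]; decide⟩

instance : NormedField (KInfty k) := Valued.toNormedField (KInfty k) ℤᵐ⁰

theorem norm_eq (x : KInfty k) :
    ‖x‖ = WithZeroMulInt.toNNReal (card_nnreal_ne_zero k) (Valued.v x) := by
  change ((WithZeroMulInt.toNNReal (card_nnreal_ne_zero k)
    (MonoidWithZeroHom.ValueGroup₀.embedding (Valued.v.restrict x)) : ℝ≥0) : ℝ) = _
  rw [Valuation.embedding_restrict]

theorem norm_tInfty : ‖tInfty k‖ = Fintype.card k := by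
  rw [norm_eq, v_tInfty]
  rw [WithZeroMulInt.toNNReal_neg_apply _ WithZero.exp_ne_zero]
  change (((Fintype.card k : ℝ≥0) ^ (1 : ℤ) : ℝ≥0) : ℝ) = _
  simp

instance : NontriviallyNormedField (KInfty k) where
  non_trivial := ⟨tInfty k, by rw [norm_tInfty]; exact_mod_cast Fintype.one_lt_card⟩

instance : IsUltrametricDist (KInfty k) :=
  IsUltrametricDist.isUltrametricDist_of_forall_norm_add_le_max_norm
    (Valued.isNonarchimedean_norm (KInfty k) ℤᵐ⁰)

instance : CompleteSpace (KInfty k) :=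
  let := Classical.decEq (RatFunc k)
  let := RatFunc.inftyValued k
  inferInstanceAs (CompleteSpace (UniformSpace.Completion (RatFunc k)))

/-- A separable closure of `k((t⁻¹))`. -/
abbrev KSep : Type _ := SeparableClosure (KInfty k)

/-- The absolute value on the separable closure is the unique extension of the one on
`k((t⁻¹))`. -/
instance : NormedField (KSep k) := spectralNorm.normedField (KInfty k) (KSep k)

instance : NormedAlgebra (KInfty k) (KSep k) := spectralNorm.normedAlgebra (KInfty k) (KSep k)

instance : IsUltrametricDist (KSep k) :=
  IsUltrametricDist.isUltrametricDist_of_forall_norm_add_le_max_norm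
    (isNonarchimedean_spectralNorm (K := KInfty k) (L := KSep k))

instance : IsScalarTower k k[X] (KSep k) := IsScalarTower.of_algebraMap_eq fun c => by
  rw [IsScalarTower.algebraMap_apply k[X] (KInfty k) (KSep k),
    ← IsScalarTower.algebraMap_apply k k[X] (KInfty k),
    ← IsScalarTower.algebraMap_apply k (KInfty k) (KSep k)]

end Fields


section Module

variable (k : Type*) [Field k] [Fintype k]

/-- The action `φ(t) = t + τ` of `t` on the Carlitz module, where `τ` is the `#k`-th power map. -/
def carlitzT (B : Type*) [CommRing B] [Algebra k B] [Algebra k[X] B] : Module.End k B :=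
  LinearMap.mulLeft k (algebraMap k[X] B X) + (FiniteField.frobeniusAlgHom k B).toLinearMap

/-- The `k[t]`-module `E(B)` of `B`-valued points of the Carlitz module `E`: the additive group
of `B` on which `t` acts as `φ(t)`. -/
abbrev E (B : Type*) [CommRing B] [Algebra k B] [Algebra k[X] B] : Type _ :=
  Module.AEval' (carlitzT k B)

/-- The identification of the additive group of `B` with `E(B)`. -/
abbrev toE (B : Type*) [CommRing B] [Algebra k B] [Algebra k[X] B] : B ≃ₗ[k] E k B :=
  Module.AEval'.of (carlitzT k B)

theorem X_smul_toE {B : Type*} [CommRing B] [Algebra k B] [Algebra k[X] B] (b : B) :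
    (X : k[X]) • toE k B b = toE k B (algebraMap k[X] B X * b + b ^ Fintype.card k) :=
  Module.AEval'.X_smul_of _ _

/-- A `k`-linear map that commutes with `t` is `k[t]`-linear. -/
def linearOfX {M N : Type*} [AddCommGroup M] [Module k M] [Module k[X] M] [IsScalarTower k k[X] M]
    [AddCommGroup N] [Module k N] [Module k[X] N] [IsScalarTower k k[X] N]
    (f : M →ₗ[k] N) (hf : ∀ m, f ((X : k[X]) • m) = (X : k[X]) • f m) : M →ₗ[k[X]] N where
  toFun := f
  map_add' := map_add f
  map_smul' p := by
    have hC (c : k) : (∀ m : M, (C c : k[X]) • m = c • m) ∧ ∀ n : N, (C c : k[X]) • n = c • n := by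
      constructor <;> intro m <;> rw [← algebraMap_smul k[X] c m] <;> rfl
    induction p using Polynomial.induction_on' with
    | add p q hp hq => intro m; simp only [add_smul, map_add, hp, hq, RingHom.id_apply] at *
    | monomial n c =>
      induction n with
      | zero => intro m; simp [(hC c).1, (hC c).2]
      | succ n ih =>
        intro m
        have := ih ((X : k[X]) • m)
        rw [hf, RingHom.id_apply, ← mul_smul, ← mul_smul] at this
        simpa [Polynomial.monomial_mul_X] using this

/-- A homomorphism `B → C` of `k[t]`-algebras induces a map `E(B) → E(C)`. -/
def mapE {B C : Type*} [CommRing B] [Algebra k B] [Algebra k[X] B] [IsScalarTower k k[X] B]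
    [CommRing C] [Algebra k C] [Algebra k[X] C] [IsScalarTower k k[X] C] (f : B →ₐ[k[X]] C) :
    E k B →ₗ[k[X]] E k C :=
  linearOfX k (toE k C ∘ₗ (f.restrictScalars k).toLinearMap ∘ₗ (toE k B).symm) fun m => by
    obtain ⟨b, rfl⟩ := (toE k B).surjective m
    simp [X_smul_toE]

theorem mapE_toE {B C : Type*} [CommRing B] [Algebra k B] [Algebra k[X] B] [IsScalarTower k k[X] B]
    [CommRing C] [Algebra k C] [Algebra k[X] C] [IsScalarTower k k[X] C] (f : B →ₐ[k[X]] C) (b : B) :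
    mapE k f (toE k B b) = toE k C (f b) := rfl

end Module

section Exp

variable (k : Type*) [Field k] [Fintype k]

/-- The coefficients `e_i` of the Carlitz exponential `∑ e_i X ^ (q ^ i)`. They are determined by
`e_0 = 1` and `φ(t) (exp X) = exp (t X)`, see `carlitzExpCoeff_spec`. -/
def carlitzExpCoeff : ℕ → RatFunc k
  | 0 => 1
  | i + 1 => carlitzExpCoeff i ^ Fintype.card k /
      (RatFunc.X ^ Fintype.card k ^ (i + 1) - RatFunc.X)

/-- The coefficients `l_i` of the Carlitz logarithm `∑ l_i X ^ (q ^ i)`, the inverse power series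
of the exponential, see `carlitzExpCoeff_comp_carlitzLogCoeff`. -/
def carlitzLogCoeff : ℕ → RatFunc k
  | 0 => 1
  | i + 1 => carlitzLogCoeff i / (RatFunc.X - RatFunc.X ^ Fintype.card k ^ (i + 1))

theorem ratFunc_X_pow_sub_ne_zero (i : ℕ) :
    (RatFunc.X ^ Fintype.card k ^ (i + 1) - RatFunc.X : RatFunc k) ≠ 0 := by
  have h1 : 1 < Fintype.card k ^ (i + 1) := Nat.one_lt_pow (by omega) Fintype.one_lt_card
  have h := FiniteField.X_pow_card_sub_X_ne_zero k h1
  have := (map_ne_zero_iff (algebraMap k[X] (RatFunc k)) (RatFunc.algebraMap_injective k)).2 h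
  simpa using this

theorem carlitzExpCoeff_spec (i : ℕ) :
    RatFunc.X * carlitzExpCoeff k (i + 1) + carlitzExpCoeff k i ^ Fintype.card k =
      carlitzExpCoeff k (i + 1) * RatFunc.X ^ Fintype.card k ^ (i + 1) := by
  have h := ratFunc_X_pow_sub_ne_zero k i
  rw [carlitzExpCoeff]
  field_simp
  ring

theorem carlitzLogCoeff_spec (i : ℕ) :
    carlitzLogCoeff k (i + 1) * RatFunc.X ^ Fintype.card k ^ (i + 1) + carlitzLogCoeff k i =
      RatFunc.X * carlitzLogCoeff k (i + 1) := by
  have h := ratFunc_X_pow_sub_ne_zero k i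
  have h' : (RatFunc.X - RatFunc.X ^ Fintype.card k ^ (i + 1) : RatFunc k) ≠ 0 := by
    rw [← neg_sub]; exact neg_ne_zero.2 h
  rw [carlitzLogCoeff]
  field_simp
  ring

theorem add_pow_card_pow {B : Type*} [CommRing B] [Algebra k B] (x y : B) (i : ℕ) :
    (x + y) ^ Fintype.card k ^ i = x ^ Fintype.card k ^ i + y ^ Fintype.card k ^ i := by
  induction i with
  | zero => simp
  | succ i ih =>
    rw [pow_succ, pow_mul, ih, pow_mul, pow_mul]
    exact map_add (FiniteField.frobeniusAlgHom k B) _ _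

/-- The Carlitz logarithm is the inverse of the Carlitz exponential, as a power series. -/
theorem carlitzExpCoeff_comp_carlitzLogCoeff (n : ℕ) :
    ∑ p ∈ Finset.HasAntidiagonal.antidiagonal n,
      carlitzExpCoeff k p.1 * carlitzLogCoeff k p.2 ^ Fintype.card k ^ p.1 =
        if n = 0 then 1 else 0 := by
  induction n with
  | zero => simp [carlitzExpCoeff, carlitzLogCoeff]
  | succ n ih =>
    set q := Fintype.card k with hq
    have hq0 : q ≠ 0 := Fintype.card_ne_zero
    set a : ℕ × ℕ → RatFunc k :=
      fun p => carlitzExpCoeff k p.1 * carlitzLogCoeff k p.2 ^ q ^ p.1 with ha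
    set T : RatFunc k := RatFunc.X with hT
    let u : ℕ × ℕ → RatFunc k := fun p => if p.1 = 0 then 0 else a (p.1 - 1, p.2) ^ q
    let w : ℕ × ℕ → RatFunc k := fun p => if p.2 = 0 then 0 else a (p.1, p.2 - 1)
    have hl (i j : ℕ) : a (i, j) * T ^ q ^ (i + j) =
        carlitzExpCoeff k i * T ^ q ^ i * carlitzLogCoeff k j ^ q ^ i - w (i, j) := by
      cases j with
      | zero => simp [w, a, carlitzLogCoeff]
      | succ j =>
        have h := congrArg (· ^ q ^ i) (carlitzLogCoeff_spec k j)
        beta_reduce at h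
        rw [hq, add_pow_card_pow, ← hq, ← hT, mul_pow, mul_pow] at h
        rw [← pow_mul, ← pow_add, add_comm (j + 1) i] at h
        simp only [w, a, Nat.add_sub_cancel, Nat.add_one_ne_zero, if_false]
        linear_combination carlitzExpCoeff k i * h
    have he (i j : ℕ) : carlitzExpCoeff k i * T ^ q ^ i * carlitzLogCoeff k j ^ q ^ i =
        T * a (i, j) + u (i, j) := by
      cases i with
      | zero => simp [u, a, carlitzExpCoeff, mul_comm]
      | succ i =>
        have h := carlitzExpCoeff_spec k i
        simp only [u, a, Nat.add_sub_cancel, Nat.add_one_ne_zero, if_false, mul_pow, ← pow_mul,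
          ← pow_succ]
        linear_combination (- carlitzLogCoeff k j ^ q ^ (i + 1)) * h
    have hs : (T ^ q ^ (n + 1) - T) * ∑ p ∈ Finset.HasAntidiagonal.antidiagonal (n + 1), a p =
        ∑ p ∈ Finset.HasAntidiagonal.antidiagonal (n + 1), u p -
          ∑ p ∈ Finset.HasAntidiagonal.antidiagonal (n + 1), w p := by
      rw [Finset.mul_sum, ← Finset.sum_sub_distrib]
      refine Finset.sum_congr rfl fun p hp => ?_
      rw [Finset.HasAntidiagonal.mem_antidiagonal] at hp
      have h := hl p.1 p.2
      rw [he, hp] at h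
      linear_combination h
    rw [Finset.Nat.sum_antidiagonal_succ (f := u), Finset.Nat.sum_antidiagonal_succ' (f := w)] at hs
    simp only [u, w, Nat.add_sub_cancel, Nat.add_one_ne_zero, if_false, if_true, zero_add] at hs
    have hf : ∑ p ∈ Finset.HasAntidiagonal.antidiagonal n, a p ^ q =
        (∑ p ∈ Finset.HasAntidiagonal.antidiagonal n, a p) ^ q :=
      (map_sum (FiniteField.frobeniusAlgHom k (RatFunc k)) a _).symm
    rw [hf, ih] at hs
    have h0 : (T ^ q ^ (n + 1) - T) * ∑ p ∈ Finset.HasAntidiagonal.antidiagonal (n + 1), a p = 0 := by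
      rw [hs]; split_ifs <;> simp [hq0]
    simpa using (mul_eq_zero.1 h0).resolve_left (ratFunc_X_pow_sub_ne_zero k n)

end Exp

section Convergence

variable (k : Type*) [Field k] [Fintype k]

theorem norm_carlitzExpCoeff (i : ℕ) :
    ‖algebraMap (RatFunc k) (KInfty k) (carlitzExpCoeff k i)‖ =
      ((Fintype.card k : ℝ) ^ (i * Fintype.card k ^ i))⁻¹ := by
  have hq : (1 : ℝ) < Fintype.card k := by exact_mod_cast Fintype.one_lt_card
  have hX : algebraMap (RatFunc k) (KInfty k) RatFunc.X = tInfty k := by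
    rw [tInfty, IsScalarTower.algebraMap_apply k[X] (RatFunc k) (KInfty k), RatFunc.algebraMap_X]
  induction i with
  | zero => simp [carlitzExpCoeff]
  | succ i ih =>
    have h1 : ‖tInfty k ^ Fintype.card k ^ (i + 1) - tInfty k‖ =
        (Fintype.card k : ℝ) ^ Fintype.card k ^ (i + 1) := by
      have hlt : ‖tInfty k‖ < ‖tInfty k ^ Fintype.card k ^ (i + 1)‖ := by
        rw [norm_pow, norm_tInfty]
        exact lt_self_pow₀ hq (Nat.one_lt_pow (by omega) Fintype.one_lt_card)
      rw [sub_eq_add_neg, IsUltrametricDist.norm_add_eq_max_of_norm_ne_norm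
        (by rw [norm_neg]; exact hlt.ne'), norm_neg, max_eq_left hlt.le, norm_pow, norm_tInfty]
    rw [carlitzExpCoeff, map_div₀, map_sub, map_pow, map_pow, hX, norm_div, norm_pow, ih, h1,
      inv_pow, ← pow_mul, div_eq_mul_inv, ← mul_inv, ← pow_add]
    congr 2
    ring

variable (L : Type*) [NormedField L] [NormedAlgebra (KInfty k) L]

/-- The `i`-th term `e_i y ^ (q ^ i)` of the exponential series. -/
def carlitzExpTerm (y : L) (i : ℕ) : L :=
  algebraMap (RatFunc k) (KInfty k) (carlitzExpCoeff k i) • y ^ Fintype.card k ^ i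

/-- The `i`-th term `l_i z ^ (q ^ i)` of the logarithm series. -/
def carlitzLogTerm (z : L) (i : ℕ) : L :=
  algebraMap (RatFunc k) (KInfty k) (carlitzLogCoeff k i) • z ^ Fintype.card k ^ i

/-- The Carlitz logarithm `log z = ∑ l_i z ^ (q ^ i)`, where the series converges. -/
def carlitzLog (z : L) : L := ∑' i, carlitzLogTerm k L z i

theorem norm_carlitzExpTerm (y : L) (i : ℕ) :
    ‖carlitzExpTerm k L y i‖ =
      (‖y‖ / (Fintype.card k : ℝ) ^ i) ^ Fintype.card k ^ i := by
  rw [carlitzExpTerm, norm_smul, norm_carlitzExpCoeff, norm_pow, div_pow, ← pow_mul, mul_comm,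
    div_eq_mul_inv]

theorem tendsto_carlitzExpTerm (y : L) :
    Filter.Tendsto (carlitzExpTerm k L y) Filter.atTop (nhds 0) := by
  have hq : (1 : ℝ) < Fintype.card k := by exact_mod_cast Fintype.one_lt_card
  rw [tendsto_zero_iff_norm_tendsto_zero]
  have h1 : Filter.Tendsto (fun i : ℕ => ‖y‖ / (Fintype.card k : ℝ) ^ i) Filter.atTop (nhds 0) :=
    tendsto_const_nhds.div_atTop (tendsto_pow_atTop_atTop_of_one_lt hq)
  refine squeeze_zero' (Filter.Eventually.of_forall fun i => norm_nonneg _) ?_ h1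
  filter_upwards [h1.eventually (gt_mem_nhds zero_lt_one)] with i hi
  rw [norm_carlitzExpTerm]
  exact pow_le_of_le_one (by positivity) hi.le (pow_ne_zero _ Fintype.card_ne_zero)

variable [IsUltrametricDist L]

/-- A sequence in a finite extension of `k((t⁻¹))` that tends to zero is summable there. -/
theorem summable_of_tendsto_zero (F : IntermediateField (KInfty k) L)
    [FiniteDimensional (KInfty k) F] (f : ℕ → L) (hF : ∀ i, f i ∈ F)
    (hf : Filter.Tendsto f Filter.atTop (nhds 0)) : Summable f ∧ ∑' i, f i ∈ F := by
  have hfd : FiniteDimensional (KInfty k) (Subalgebra.toSubmodule F.toSubalgebra) :=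
    inferInstanceAs (FiniteDimensional (KInfty k) F)
  have hc : IsComplete (F : Set L) := by
    have : CompleteSpace (Subalgebra.toSubmodule F.toSubalgebra) :=
      FiniteDimensional.complete (KInfty k) _
    exact completeSpace_coe_iff_isComplete.1 this
  rw [← Nat.cofinite_eq_atTop] at hf
  obtain ⟨x, hx, hs⟩ := cauchySeq_tendsto_of_isComplete hc (fun _ => sum_mem fun i _ => hF i)
    (NonarchimedeanAddGroup.cauchySeq_sum_of_tendsto_cofinite_zero hf)
  have hs : HasSum f x := hs
  exact ⟨hs.summable, hs.tsum_eq ▸ hx⟩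

theorem summable_carlitzExpTerm (F : IntermediateField (KInfty k) L)
    [FiniteDimensional (KInfty k) F] (y : L) (hy : y ∈ F) :
    Summable (carlitzExpTerm k L y) ∧ ∑' i, carlitzExpTerm k L y i ∈ F :=
  summable_of_tendsto_zero k L F _ (fun _ => F.smul_mem (pow_mem hy _))
    (tendsto_carlitzExpTerm k L y)

variable [Algebra.IsAlgebraic (KInfty k) L]

theorem hasSum_carlitzExpTerm (y : L) :
    HasSum (carlitzExpTerm k L y) (∑' i, carlitzExpTerm k L y i) := by
  have : FiniteDimensional (KInfty k) (IntermediateField.adjoin (KInfty k) {y}) :=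
    IntermediateField.adjoin.finiteDimensional (Algebra.IsIntegral.isIntegral y)
  exact (summable_carlitzExpTerm k L _ y (IntermediateField.mem_adjoin_simple_self _ y)).1.hasSum

theorem norm_tsum_carlitzExpTerm_sub_le (y : L) (hy : ‖y‖ ≤ Fintype.card k) :
    ‖∑' i, carlitzExpTerm k L y i - y‖ ≤ ‖y‖ / Fintype.card k := by
  have hq : (1 : ℝ) < Fintype.card k := by exact_mod_cast Fintype.one_lt_card
  have h := (hasSum_carlitzExpTerm k L y)
  rw [← hasSum_nat_add_iff' 1] at h
  have h0 : carlitzExpTerm k L y 0 = y := by simp [carlitzExpTerm, carlitzExpCoeff]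
  rw [Finset.sum_range_one, h0] at h
  rw [← h.tsum_eq]
  refine IsUltrametricDist.norm_tsum_le_of_forall_le_of_nonneg (by positivity) fun i => ?_
  rw [norm_carlitzExpTerm]
  have hle : ‖y‖ / (Fintype.card k : ℝ) ^ (i + 1) ≤ ‖y‖ / Fintype.card k :=
    div_le_div_of_nonneg_left (norm_nonneg y) (by positivity) (le_self_pow₀ hq.le (by omega))
  refine le_trans ?_ hle
  exact pow_le_of_le_one (by positivity) (hle.trans ((div_le_one (by positivity)).2 hy))
    (pow_ne_zero _ Fintype.card_ne_zero)

variable [Algebra k L] [Algebra k[X] L] [IsScalarTower k k[X] L] [IsScalarTower k[X] (KInfty k) L]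

/-- The functional equation `exp (t y) = t exp y + (exp y) ^ q`. -/
theorem tsum_carlitzExpTerm_X (y : L) :
    ∑' i, carlitzExpTerm k L (algebraMap k[X] L X * y) i =
      algebraMap k[X] L X * (∑' i, carlitzExpTerm k L y i) +
        (∑' i, carlitzExpTerm k L y i) ^ Fintype.card k := by
  set T := algebraMap k[X] L X with hT
  set e : ℕ → KInfty k := fun i => algebraMap (RatFunc k) (KInfty k) (carlitzExpCoeff k i) with he
  have hX : algebraMap (RatFunc k) (KInfty k) RatFunc.X = tInfty k := by
    rw [tInfty, IsScalarTower.algebraMap_apply k[X] (RatFunc k) (KInfty k), RatFunc.algebraMap_X]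
  have hT' : T = algebraMap (KInfty k) L (tInfty k) := by
    rw [hT, IsScalarTower.algebraMap_apply k[X] (KInfty k) L]; rfl
  have hstep (i : ℕ) : carlitzExpTerm k L (T * y) (i + 1) - T * carlitzExpTerm k L y (i + 1) =
      carlitzExpTerm k L y i ^ Fintype.card k := by
    have h := congrArg (fun r => algebraMap (KInfty k) L (algebraMap (RatFunc k) (KInfty k) r))
      (carlitzExpCoeff_spec k i)
    simp only [map_add, map_mul, map_pow, hX, ← hT'] at h
    simp only [carlitzExpTerm, Algebra.smul_def, mul_pow, ← pow_mul, ← pow_succ]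
    linear_combination (-y ^ Fintype.card k ^ (i + 1)) * h
  have h0 : carlitzExpTerm k L (T * y) 0 - T * carlitzExpTerm k L y 0 = 0 := by
    simp [carlitzExpTerm, carlitzExpCoeff]
  have hy := hasSum_carlitzExpTerm k L y
  have h1 := (hasSum_carlitzExpTerm k L (T * y)).sub (hy.mul_left T)
  have h2 : HasSum (fun i => carlitzExpTerm k L y i ^ Fintype.card k)
      ((∑' i, carlitzExpTerm k L y i) ^ Fintype.card k) :=
    hy.map (FiniteField.frobeniusAlgHom k L) (continuous_pow (Fintype.card k))
  rw [← hasSum_nat_add_iff' 1] at h1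
  simp only [hstep, Finset.sum_range_one, h0, sub_zero] at h1
  linear_combination -(h2.unique h1)

/-- The Carlitz exponential `exp : Lie_E(L) → E(L)`, `y ↦ ∑ e_i y ^ (q ^ i)`, for an algebraic
extension `L` of `k((t⁻¹))`. Here `Lie_E(L)` is `L` itself, with its obvious `k[t]`-module
structure. -/
def carlitzExp : L →ₗ[k[X]] E k L :=
  linearOfX k (toE k L ∘ₗ
    { toFun := fun y => ∑' i, carlitzExpTerm k L y i
      map_add' := fun x y => by
        rw [← (hasSum_carlitzExpTerm k L x).summable.tsum_add
          (hasSum_carlitzExpTerm k L y).summable]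
        congr 1
        funext i
        rw [carlitzExpTerm, add_pow_card_pow, smul_add]; rfl
      map_smul' := fun c y => by
        rw [RingHom.id_apply, ← (hasSum_carlitzExpTerm k L y).summable.tsum_const_smul]
        congr 1
        funext i
        have hc : c ^ Fintype.card k ^ i = c := FiniteField.pow_card_pow i c
        rw [carlitzExpTerm, carlitzExpTerm, Algebra.smul_def c, Algebra.smul_def c, mul_pow,
          ← map_pow, hc, mul_smul_comm] })
    fun y => by
      simp only [LinearMap.comp_apply, LinearEquiv.coe_coe, LinearMap.coe_mk, AddHom.coe_mk]
      rw [X_smul_toE, Algebra.smul_def, tsum_carlitzExpTerm_X]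

theorem carlitzExp_apply (y : L) : carlitzExp k L y = toE k L (∑' i, carlitzExpTerm k L y i) := rfl


theorem continuous_tsum_carlitzExpTerm : Continuous fun y : L => ∑' i, carlitzExpTerm k L y i := by
  have hq : (1 : ℝ) < Fintype.card k := by exact_mod_cast Fintype.one_lt_card
  refine continuous_of_continuousAt_zero
    ((toE k L).symm.toLinearMap.toAddMonoidHom.comp (carlitzExp k L).toAddMonoidHom) ?_
  have h1 : Filter.Tendsto (fun y : L => ∑' i, carlitzExpTerm k L y i - y) (nhds 0) (nhds 0) := by
    rw [tendsto_zero_iff_norm_tendsto_zero]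
    refine squeeze_zero' (.of_forall fun _ => norm_nonneg _) ?_
      (g := fun y => ‖y‖ / Fintype.card k) ?_
    · filter_upwards [Metric.closedBall_mem_nhds (0 : L) (zero_lt_one.trans hq)] with y hy
      exact norm_tsum_carlitzExpTerm_sub_le k L y (by simpa using hy)
    · have := (continuous_norm (E := L)).tendsto 0
      simpa using this.div_const (Fintype.card k : ℝ)
  have h2 := h1.add (Filter.tendsto_id (α := L) (x := nhds 0))
  simp only [sub_add_cancel, id, add_zero] at h2
  rw [ContinuousAt, map_zero]
  exact h2

theorem exists_tsum_carlitzExpTerm_eq (a : L) (ha : ‖a‖ ≤ Fintype.card k) :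
    ∃ y : L, ∑' i, carlitzExpTerm k L y i = a := by
  have hq : (1 : ℝ) < Fintype.card k := by exact_mod_cast Fintype.one_lt_card
  let S : L →+ L :=
    (toE k L).symm.toLinearMap.toAddMonoidHom.comp (carlitzExp k L).toAddMonoidHom
  have hS (y : L) : S y = ∑' i, carlitzExpTerm k L y i := rfl
  let r : ℕ → L := fun n => (fun z => z - S z)^[n] a
  have hr (n : ℕ) : r (n + 1) = r n - S (r n) := Function.iterate_succ_apply' _ _ _
  have hr0 : r 0 = a := rfl
  have hfd : FiniteDimensional (KInfty k) (IntermediateField.adjoin (KInfty k) {a}) :=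
    IntermediateField.adjoin.finiteDimensional (Algebra.IsIntegral.isIntegral a)
  have hmem (n : ℕ) : r n ∈ IntermediateField.adjoin (KInfty k) {a} := by
    induction n with
    | zero => exact IntermediateField.mem_adjoin_simple_self _ a
    | succ n ih => rw [hr]; exact sub_mem ih (summable_carlitzExpTerm k L _ _ ih).2
  have hnorm (n : ℕ) : ‖r n‖ ≤ ‖a‖ / (Fintype.card k : ℝ) ^ n := by
    induction n with
    | zero => simp [hr0]
    | succ n ih =>
      have h1 : ‖a‖ / (Fintype.card k : ℝ) ^ n ≤ ‖a‖ :=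
        div_le_self (norm_nonneg a) (one_le_pow₀ hq.le)
      rw [hr, norm_sub_rev, hS, pow_succ, ← div_div]
      exact (norm_tsum_carlitzExpTerm_sub_le k L _ (ih.trans (h1.trans ha))).trans
        (by gcongr)
  have hlim : Filter.Tendsto r Filter.atTop (nhds 0) := by
    rw [tendsto_zero_iff_norm_tendsto_zero]
    exact squeeze_zero (fun _ => norm_nonneg _) hnorm
      (tendsto_const_nhds.div_atTop (tendsto_pow_atTop_atTop_of_one_lt hq))
  have hsum := (summable_of_tendsto_zero k L _ r hmem hlim).1.hasSum
  refine ⟨∑' n, r n, ?_⟩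
  have h1 : HasSum (fun n => S (r n)) (S (∑' n, r n)) :=
    hsum.map S (continuous_tsum_carlitzExpTerm k L)
  have h2 := hsum.sub ((hasSum_nat_add_iff' 1).2 hsum)
  have h3 (n : ℕ) : r n - r (n + 1) = S (r n) := by rw [hr]; ring
  simp only [h3, Finset.sum_range_one, hr0, sub_sub_cancel] at h2
  rw [← hS]
  exact h1.unique h2

end Convergence

section Separable

variable (k : Type*) [Field k] [Fintype k]

/-- The exponential `Lie_E(k((t⁻¹))^sep) → E(k((t⁻¹))^sep)` is surjective. -/
theorem carlitzExp_surjective : Function.Surjective (carlitzExp k (KSep k)) := by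
  have hq : (1 : ℝ) < Fintype.card k := by exact_mod_cast Fintype.one_lt_card
  have hX : algebraMap k[X] (KSep k) X = algebraMap (KInfty k) (KSep k) (tInfty k) := by
    rw [IsScalarTower.algebraMap_apply k[X] (KInfty k) (KSep k)]; rfl
  have hT : ‖algebraMap k[X] (KSep k) X‖ = Fintype.card k := by
    rw [hX, norm_algebraMap', norm_tInfty]
  have key (n : ℕ) : ∀ a : KSep k, ‖a‖ ≤ (Fintype.card k : ℝ) ^ (n + 1) →
      ∃ y : KSep k, ∑' i, carlitzExpTerm k (KSep k) y i = a := by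
    induction n with
    | zero => intro a ha; exact exists_tsum_carlitzExpTerm_eq k (KSep k) a (by simpa using ha)
    | succ n ih =>
      intro a ha
      have hcard : ((Fintype.card k : ℕ) : KSep k) = 0 := by
        rw [← map_natCast (algebraMap k (KSep k)), FiniteField.cast_card_eq_zero, map_zero]
      have hT0 : algebraMap k[X] (KSep k) X ≠ 0 := by
        rw [← norm_ne_zero_iff, hT]; positivity
      obtain ⟨x, hx⟩ := IsSepClosed.exists_root_C_mul_X_pow_add_C_mul_X_add_C
        1 (algebraMap k[X] (KSep k) X) (-a) hcard Fintype.one_lt_card hT0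
      rw [one_mul, ← sub_eq_add_neg, sub_eq_zero] at hx
      have hx' : ‖x‖ ≤ (Fintype.card k : ℝ) ^ (n + 1) := by
        by_contra! hlt
        have hx1 : (Fintype.card k : ℝ) < ‖x‖ := lt_of_le_of_lt (le_self_pow₀ hq.le (by omega)) hlt
        obtain ⟨m, hm⟩ : ∃ m, Fintype.card k = m + 2 :=
          ⟨Fintype.card k - 2, by have := Fintype.one_lt_card (α := k); omega⟩
        have hpow : (Fintype.card k : ℝ) * ‖x‖ < ‖x ^ Fintype.card k‖ := by
          rw [norm_pow, hm, pow_succ, ← hm]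
          refine mul_lt_mul_of_pos_right (hx1.trans_le ?_) (by linarith)
          exact le_self_pow₀ (hq.le.trans hx1.le) (by omega)
        have hna : ‖a‖ = ‖x ^ Fintype.card k‖ := by
          rw [← hx, IsUltrametricDist.norm_add_eq_max_of_norm_ne_norm, max_eq_left]
          · rw [norm_mul, hT]; exact hpow.le
          · rw [norm_mul, hT]; exact hpow.ne'
        have : (Fintype.card k : ℝ) ^ (n + 1 + 1) < ‖a‖ := by
          rw [hna, pow_succ']
          exact (mul_lt_mul_of_pos_left hlt (by positivity)).trans hpow
        exact absurd ha this.not_ge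
      obtain ⟨y, rfl⟩ := ih x hx'
      exact ⟨algebraMap k[X] (KSep k) X * y, by rw [tsum_carlitzExpTerm_X, ← hx, add_comm]⟩
  intro z
  obtain ⟨a, rfl⟩ := (toE k (KSep k)).surjective z
  obtain ⟨n, hn⟩ := pow_unbounded_of_one_lt ‖a‖ hq
  obtain ⟨y, hy⟩ := key n a (hn.le.trans (pow_le_pow_right₀ hq.le (by omega)))
  exact ⟨y, by rw [carlitzExp_apply, hy]⟩

/-- The Galois group of `k((t⁻¹))^sep` over `k((t⁻¹))`, with its Krull topology. -/
abbrev G : Type _ := Gal(KSep k/KInfty k)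

theorem norm_galois (σ : G k) (y : KSep k) : ‖σ y‖ = ‖y‖ :=
  (spectralNorm_eq_of_equiv (K := KInfty k) σ y).symm

theorem continuous_galois (σ : G k) : Continuous σ := by
  refine continuous_of_continuousAt_zero σ ?_
  rw [ContinuousAt, map_zero, tendsto_zero_iff_norm_tendsto_zero]
  simp_rw [norm_galois]
  simpa using (continuous_norm (E := KSep k)).tendsto 0

theorem galois_algebraMap (σ : G k) (p : k[X]) :
    σ (algebraMap k[X] (KSep k) p) = algebraMap k[X] (KSep k) p := by
  rw [IsScalarTower.algebraMap_apply k[X] (KInfty k) (KSep k), σ.commutes]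

theorem tsum_carlitzExpTerm_galois (σ : G k) (y : KSep k) :
    ∑' i, carlitzExpTerm k (KSep k) (σ y) i = σ (∑' i, carlitzExpTerm k (KSep k) y i) := by
  have h := (hasSum_carlitzExpTerm k (KSep k) y).map σ (continuous_galois k σ)
  rw [← h.tsum_eq]
  congr 1
  funext i
  simp only [Function.comp_apply, carlitzExpTerm]
  rw [map_smul, map_pow]

/-- The period lattice `Λ_E`, the kernel of the exponential on `k((t⁻¹))^sep`. It carries the
subspace topology of `k((t⁻¹))^sep`. -/
def Lam : Submodule k[X] (KSep k) := LinearMap.ker (carlitzExp k (KSep k))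

theorem mem_Lam {y : KSep k} : y ∈ Lam k ↔ ∑' i, carlitzExpTerm k (KSep k) y i = 0 := by
  rw [Lam, LinearMap.mem_ker, carlitzExp_apply, LinearEquiv.map_eq_zero_iff]

instance : DistribMulAction (G k) (Lam k) where
  smul σ y := ⟨σ y, by
    rw [mem_Lam, tsum_carlitzExpTerm_galois, (mem_Lam k).1 y.2, map_zero]⟩
  one_smul _ := rfl
  mul_smul _ _ _ := rfl
  smul_zero σ := Subtype.ext (map_zero σ)
  smul_add σ x y := Subtype.ext (map_add σ (x : KSep k) y)

@[simp] theorem coe_galois_smul_Lam (σ : G k) (y : Lam k) : ((σ • y : Lam k) : KSep k) = σ y := rfl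

theorem galois_smul (σ : G k) (p : k[X]) (y : KSep k) : σ (p • y) = p • σ y := by
  rw [Algebra.smul_def, map_mul, galois_algebraMap, Algebra.smul_def]

instance : SMulCommClass (G k) k[X] (Lam k) where
  smul_comm σ p y := Subtype.ext (galois_smul k σ p y)

instance : ContinuousConstSMul k[X] (KSep k) where
  continuous_const_smul p := by
    simp_rw [Algebra.smul_def]
    exact continuous_const.mul continuous_id

instance : ContinuousConstSMul k[X] (Lam k) where
  continuous_const_smul p :=
    ((continuous_const_smul p).comp continuous_subtype_val).subtype_mk fun y => (p • y).2

end Separable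

section Cohomology

variable (A G M : Type*) [CommRing A] [Group G] [TopologicalSpace G] [AddCommGroup M] [Module A M]
  [DistribMulAction G M] [SMulCommClass G A M] [TopologicalSpace M] [IsTopologicalAddGroup M]
  [ContinuousConstSMul A M]

/-- The continuous `1`-cocycles of `G` with values in `M`. -/
def contCocycles : Submodule A (G → M) where
  carrier := {f | Continuous f ∧ ∀ σ τ, f (σ * τ) = f σ + σ • f τ}
  zero_mem' := ⟨continuous_const, by simp⟩
  add_mem' := fun {f g} hf hg => ⟨hf.1.add hg.1, fun σ τ => by
    simp only [Pi.add_apply, hf.2, hg.2, smul_add]; abel⟩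
  smul_mem' := fun a f hf => ⟨hf.1.const_smul a, fun σ τ => by
    simp only [Pi.smul_apply, hf.2, smul_add, smul_comm σ a]⟩

instance : AddCommGroup (contCocycles A G M) := Submodule.addCommGroup _

instance : Module A (contCocycles A G M) := Submodule.module _

/-- The continuous `1`-coboundaries of `G` with values in `M`. -/
def contCoboundaries : Submodule A (contCocycles A G M) where
  carrier := {f | ∃ m : M, ∀ σ, (f : G → M) σ = σ • m - m}
  zero_mem' := ⟨0, by simp⟩
  add_mem' := by
    rintro f g ⟨m, hm⟩ ⟨n, hn⟩
    exact ⟨m + n, fun σ => by simp only [Submodule.coe_add, Pi.add_apply, hm, hn, smul_add]; abel⟩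
  smul_mem' := by
    rintro a f ⟨m, hm⟩
    exact ⟨a • m, fun σ => by
      simp only [Submodule.coe_smul, Pi.smul_apply, hm, smul_sub, smul_comm σ a]⟩

/-- The first continuous cohomology `H¹(G, M)`. -/
def H1 : Type _ := contCocycles A G M ⧸ contCoboundaries A G M

instance : AddCommGroup (H1 A G M) := Submodule.Quotient.addCommGroup (contCoboundaries A G M)

instance : Module A (H1 A G M) := Submodule.Quotient.module (contCoboundaries A G M)

/-- The class in `H¹(G, M)` of a continuous cocycle. -/
def H1mk : contCocycles A G M →ₗ[A] H1 A G M := (contCoboundaries A G M).mkQ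

theorem H1mk_surjective : Function.Surjective (H1mk A G M) :=
  (contCoboundaries A G M).mkQ_surjective

theorem H1mk_eq_zero {f : contCocycles A G M} :
    H1mk A G M f = 0 ↔ ∃ m : M, ∀ σ, (f : G → M) σ = σ • m - m :=
  Submodule.Quotient.mk_eq_zero _

end Cohomology

section Connecting

variable (k : Type*) [Field k] [Fintype k]

/-- The map `E(k((t⁻¹))) → E(k((t⁻¹))^sep)`. -/
abbrev embE : E k (KInfty k) →ₗ[k[X]] E k (KSep k) :=
  mapE k (IsScalarTower.toAlgHom k[X] (KInfty k) (KSep k))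

/-- The elements of `Lie_E(k((t⁻¹))^sep)` whose exponential is in `E(k((t⁻¹)))`. -/
def expPreimage : Submodule k[X] (KSep k) :=
  (LinearMap.range (embE k)).comap (carlitzExp k (KSep k))

theorem galois_sub_mem_Lam {y : KSep k} (hy : y ∈ expPreimage k) (σ : G k) :
    σ y - y ∈ Lam k := by
  obtain ⟨x, hx⟩ := hy
  obtain ⟨x, rfl⟩ := (toE k (KInfty k)).surjective x
  have hx' : ∑' i, carlitzExpTerm k (KSep k) y i = algebraMap (KInfty k) (KSep k) x := by
    rw [carlitzExp_apply, mapE_toE] at hx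
    exact (toE k (KSep k)).injective hx.symm
  rw [Lam, LinearMap.mem_ker, map_sub, carlitzExp_apply, carlitzExp_apply, tsum_carlitzExpTerm_galois,
    hx', AlgEquiv.commutes, sub_self]

theorem continuous_galois_apply (y : KSep k) : Continuous fun σ : G k => σ y := by
  refine IsLocallyConstant.continuous ((IsLocallyConstant.iff_exists_open _).2 fun σ => ?_)
  have hfd : FiniteDimensional (KInfty k) (IntermediateField.adjoin (KInfty k) {y}) :=
    IntermediateField.adjoin.finiteDimensional (Algebra.IsIntegral.isIntegral y)
  refine ⟨_, (IntermediateField.adjoin (KInfty k) {y}).fixingSubgroup_isOpen.smul σ,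
    ⟨1, one_mem _, mul_one σ⟩, ?_⟩
  rintro _ ⟨τ, hτ, rfl⟩
  exact congrArg σ (hτ ⟨y, IntermediateField.mem_adjoin_simple_self _ y⟩)

/-- The cocycle `σ ↦ σ y - y` attached to an element `y` of `Lie_E(k((t⁻¹))^sep)` whose
exponential is in `E(k((t⁻¹)))`. -/
def expCocycle : expPreimage k →ₗ[k[X]] contCocycles k[X] (G k) (Lam k) where
  toFun y := ⟨fun σ => ⟨σ y - y, galois_sub_mem_Lam k y.2 σ⟩,
    ((continuous_galois_apply k y).sub continuous_const).subtype_mk _, fun σ τ => by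
      apply Subtype.ext
      simp only [AlgEquiv.mul_apply, Submodule.coe_add, coe_galois_smul_Lam, map_sub]
      ring⟩
  map_add' x y := by
    apply Subtype.ext; funext σ; apply Subtype.ext
    simp only [Submodule.coe_add, map_add, Pi.add_apply]
    ring
  map_smul' p y := by
    apply Subtype.ext; funext σ; apply Subtype.ext
    simp only [Submodule.coe_smul, galois_smul, Pi.smul_apply, RingHom.id_apply, smul_sub]

/-- The class of the cocycle `σ ↦ σ y - y`. -/
def expClass : expPreimage k →ₗ[k[X]] H1 k[X] (G k) (Lam k) :=
  H1mk k[X] (G k) (Lam k) ∘ₗ expCocycle k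

theorem exists_lift (x : E k (KInfty k)) :
    ∃ y : expPreimage k, carlitzExp k (KSep k) y = embE k x := by
  obtain ⟨y, hy⟩ := carlitzExp_surjective k (embE k x)
  exact ⟨⟨y, x, hy.symm⟩, hy⟩

theorem expClass_eq {y z : expPreimage k}
    (h : carlitzExp k (KSep k) y = carlitzExp k (KSep k) z) : expClass k y = expClass k z := by
  rw [← sub_eq_zero, ← map_sub]
  refine (H1mk_eq_zero _ _ _).2 ⟨⟨y - z, ?_⟩, fun σ => rfl⟩
  rw [Lam, LinearMap.mem_ker, map_sub, h, sub_self]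

/-- The connecting homomorphism `E(k((t⁻¹))) → H¹(G, Λ_E)` of the exponential sequence: it maps
`x` to the class of `σ ↦ σ y - y` where `exp y = x`. -/
def connecting : E k (KInfty k) →ₗ[k[X]] H1 k[X] (G k) (Lam k) where
  toFun x := expClass k (exists_lift k x).choose
  map_add' x y := by
    rw [← map_add]
    apply expClass_eq
    refine Eq.trans ?_ (map_add (carlitzExp k (KSep k)) _ _).symm
    exact (exists_lift k _).choose_spec.trans ((map_add _ _ _).trans
      (congrArg₂ _ (exists_lift k x).choose_spec (exists_lift k y).choose_spec).symm)
  map_smul' p x := by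
    rw [RingHom.id_apply, ← map_smul]
    apply expClass_eq
    refine Eq.trans ?_ (map_smul (carlitzExp k (KSep k)) p _).symm
    exact (exists_lift k _).choose_spec.trans ((map_smul _ _ _).trans
      (congrArg _ (exists_lift k x).choose_spec).symm)

theorem connecting_eq (x : E k (KInfty k)) (y : expPreimage k)
    (h : carlitzExp k (KSep k) y = embE k x) : connecting k x = expClass k y :=
  expClass_eq k ((exists_lift k x).choose_spec.trans h.symm)

end Connecting

section ClassNumberFormula

/-- The first (that is, the initial) Fitting ideal of a finitely generated module `M`, generated by
the maximal minors of the matrices of relations between generators of `M`. -/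
def fittingIdeal (A M : Type*) [CommRing A] [AddCommGroup M] [Module A M] : Ideal A :=
  Ideal.span {d | ∃ (n : ℕ) (x : Fin n → M) (B : Matrix (Fin n) (Fin n) A),
    Submodule.span A (Set.range x) = ⊤ ∧ (∀ i, ∑ j, B i j • x j = 0) ∧ d = B.det}

variable (k : Type*) [Field k]

/-- The analogue `|M|` of the cardinality: the monic generator of the first Fitting ideal of a
finite `k[t]`-module `M`. -/
def fittingCard (M : Type*) [AddCommGroup M] [Module k[X] M] : k[X] :=
  C (Submodule.IsPrincipal.generator (fittingIdeal k[X] M)).leadingCoeff⁻¹ *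
    Submodule.IsPrincipal.generator (fittingIdeal k[X] M)

/-- The monic elements of `k((t⁻¹))`: those with leading term `t ^ n` for some integer `n`. -/
def IsMonic (x : KInfty k) : Prop :=
  ∃ n : ℤ, Valued.v (x - tInfty k ^ n) < Valued.v (tInfty k ^ n)

variable [Fintype k]

/-- The term `1 / |R/I|` of the series `ζ_R(1)`. -/
def zetaTerm (R : Type*) [CommRing R] [Algebra k[X] R] (I : Ideal R) : KInfty k :=
  (algebraMap k[X] (KInfty k) (fittingCard k (R ⧸ I)))⁻¹

/-- The zeta value `ζ_R(1) = ∑ 1 / |R/I|`, where `I` runs over the non-zero ideals of `R`. -/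
def zetaOne (R : Type*) [CommRing R] [Algebra k[X] R] : KInfty k :=
  ∑' I : {I : Ideal R // I ≠ ⊥}, zetaTerm k R I

/-- For `R = k[t]`, the map `E(R) → E(k((t⁻¹)))`. -/
def pointsE : E k k[X] →ₗ[k[X]] E k (KInfty k) := mapE k (Algebra.ofId k[X] (KInfty k))

/-- For `R = k[t]`, the inverse image `exp⁻¹(E(R))` in `Lie_E(k((t⁻¹))) = k((t⁻¹))`. -/
abbrev expInv : Submodule k[X] (KInfty k) :=
  (LinearMap.range (pointsE k)).comap (carlitzExp k (KInfty k))

/-- For `R = k[t]`, the map `E(R) → H¹(G, Λ_E)`. -/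
def pointsToH1 : E k k[X] →ₗ[k[X]] H1 k[X] (G k) (Lam k) := connecting k ∘ₗ pointsE k

/-- For `R = k[t]`, the cokernel `H_R` of `E(R) → H¹(G, Λ_E)`. -/
abbrev HR : Type _ := H1 k[X] (G k) (Lam k) ⧸ LinearMap.range (pointsToH1 k)

/-- For `R = k[t]`, so that `Lie_E(R) = k[t]` and `Lie_E(R) ⊗ k((t⁻¹)) = Lie_E(k((t⁻¹)))`, the map
`ρ : exp⁻¹(E(R)) ⊗ k((t⁻¹)) → Lie_E(R) ⊗ k((t⁻¹))` induced by the inclusion of `exp⁻¹(E(R))` in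
`Lie_E(k((t⁻¹)))`. -/
def rho : KInfty k ⊗[k[X]] expInv k →ₗ[KInfty k] KInfty k ⊗[k[X]] k[X] :=
  (TensorProduct.AlgebraTensorModule.rid k[X] (KInfty k) (KInfty k)).symm.toLinearMap ∘ₗ
    LinearMap.liftBaseChange (KInfty k) (expInv k).subtype

/-- `r` is a monic representative of the class of `det ρ` modulo `k[t]ˣ`, the determinant being
taken with respect to `k[t]`-bases of `exp⁻¹(E(R))` and of `Lie_E(R)`, for `R = k[t]`. -/
def IsRegulator (r : KInfty k) : Prop :=
  IsMonic k r ∧ ∃ (n : ℕ) (b : Module.Basis (Fin n) k[X] (expInv k))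
    (c : Module.Basis (Fin n) k[X] k[X]) (u : k[X]ˣ),
      r = algebraMap k[X] (KInfty k) u *
        (LinearMap.toMatrix (b.baseChange (KInfty k)) (c.baseChange (KInfty k)) (rho k)).det

/-- For `R = k[t]`, the regulator `Reg_R`: the monic representative of `det ρ`. -/
def Reg : KInfty k := Classical.epsilon (IsRegulator k)

end ClassNumberFormula

end Carlitz

end

/-!
Write `K = k((t⁻¹))`, `q = #k`, and normalise `‖t‖ = q`. Two estimates carry the proof.

* `K` is the sum of `k[t]` and the open unit ball (`exists_polynomial_norm_sub_lt_one`), while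
  non-zero polynomials have absolute value at least `1`.
* `exp` preserves the absolute value on the ball of radius `q` (`norm_tsum_carlitzExpTerm`), and in
  `K` it is surjective onto that ball.

*The unit `log 1`.* Rearranging an absolutely convergent double series gives `exp (log 1) = 1`, so
`k[t] log 1 ⊆ exp⁻¹(E(k[t]))`. As `‖log 1 - 1‖ < 1`, an element of `exp⁻¹(E(k[t]))` differs from a
multiple of `log 1` by some `r` with `‖r‖ < 1`; then `exp r` is a polynomial of absolute value
`‖r‖ < 1`, so `r = 0` (`expInv_eq_span`). Hence `det ρ` is `log 1` up to a constant, and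
`Reg = log 1`.

*Cohomology.* The lattice `Λ_E` is discrete by the second estimate, so a continuous cocycle with
values in it is locally constant and, by additive Hilbert 90 in `k((t⁻¹))^sep`
(`exists_eq_galois_sub_self`), of the form `σ ↦ σ y - y`. Then `exp y` is fixed by Galois, and the
class of the cocycle is the image of `exp y ∈ K`. Thus `E(K) → H¹(G, Λ_E)` is surjective; it kills
`exp K`, and `K = k[t] + exp K`. So `E(k[t]) → H¹(G, Λ_E)` is surjective and `H_R = 0`.

*The zeta value.* Non-zero ideals correspond to monic polynomials `a`, and `|k[t]/(a)| = a`. It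
remains to show that the sum of `1 / a` over the monic `a` of degree `d` is the coefficient `l_d`
of the logarithm (`sum_inv_monic`). Let `ψ_d(x)` be the coefficient of `z ^ (q ^ d)` in
`exp (x log z)`. For `x ∈ k[t]` that series is the polynomial by which `x` acts on the Carlitz
module, so `ψ_d` vanishes at the `q ^ d` polynomials of degree less than `d` and `ψ_d(t ^ d) = 1`.
As a polynomial in `x`, `ψ_d` has degree `q ^ d` and constant derivative `l_d`; its logarithmic
derivative at `t ^ d` is therefore both `l_d` and `∑ 1 / (t ^ d - a)` over `deg a < d`.
-/

noncomputable section

namespace Carlitz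

/-! ### The absolute value on `k((t⁻¹))` -/

section AbsoluteValue

variable (k : Type*) [Field k] [Fintype k]

theorem one_lt_card_real : (1 : ℝ) < Fintype.card k := by
  exact_mod_cast Fintype.one_lt_card

theorem norm_algebraMap_polynomial {p : k[X]} (hp : p ≠ 0) :
    ‖algebraMap k[X] (KInfty k) p‖ = (Fintype.card k : ℝ) ^ p.natDegree := by
  classical
  have hv : Valued.v (algebraMap k[X] (KInfty k) p) = WithZero.exp (p.natDegree : ℤ) := by
    rw [IsScalarTower.algebraMap_apply k[X] (RatFunc k) (KInfty k), v_algebraMap]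
    exact @RatFunc.inftyValuation.polynomial k _ (Classical.decEq _) p hp
  rw [norm_eq, hv, WithZeroMulInt.toNNReal_neg_apply _ WithZero.exp_ne_zero]
  change (((Fintype.card k : ℝ≥0) ^ (p.natDegree : ℤ) : ℝ≥0) : ℝ) = _
  simp

theorem one_le_norm_algebraMap_polynomial {p : k[X]} (hp : p ≠ 0) :
    1 ≤ ‖algebraMap k[X] (KInfty k) p‖ := by
  rw [norm_algebraMap_polynomial k hp]
  exact one_le_pow₀ (one_lt_card_real k).le

theorem algebraMap_polynomial_injective : Function.Injective (algebraMap k[X] (KInfty k)) := by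
  rw [injective_iff_map_eq_zero]
  intro p hp
  by_contra h
  have := one_le_norm_algebraMap_polynomial k h
  rw [hp, norm_zero] at this
  linarith

/-- Integral parts exist in `k((t⁻¹))`: rational functions are dense, and the integral part of a
rational function is the quotient of a division with remainder. -/
theorem exists_polynomial_norm_sub_lt_one (x : KInfty k) :
    ∃ p : k[X], ‖x - algebraMap k[X] (KInfty k) p‖ < 1 := by
  have hd : DenseRange (algebraMap (RatFunc k) (KInfty k)) :=
    let _ := Classical.decEq (RatFunc k)
    let _ := RatFunc.inftyValued k
    UniformSpace.Completion.denseRange_coe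
  obtain ⟨r, hr⟩ := Metric.denseRange_iff.1 hd x 1 one_pos
  rw [dist_eq_norm] at hr
  have hden := RatFunc.denom_ne_zero r
  have hrem : ‖algebraMap (RatFunc k) (KInfty k) r -
      algebraMap k[X] (KInfty k) (r.num / r.denom)‖ < 1 := by
    have hden' : algebraMap k[X] (KInfty k) r.denom ≠ 0 :=
      (map_ne_zero_iff _ (algebraMap_polynomial_injective k)).2 hden
    have h : algebraMap (RatFunc k) (KInfty k) r -
        algebraMap k[X] (KInfty k) (r.num / r.denom) =
        algebraMap k[X] (KInfty k) (r.num % r.denom) / algebraMap k[X] (KInfty k) r.denom := by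
      conv_lhs => rw [← RatFunc.num_div_denom r]
      rw [map_div₀, ← IsScalarTower.algebraMap_apply, ← IsScalarTower.algebraMap_apply,
        sub_eq_iff_eq_add, div_eq_iff hden', add_mul, div_mul_cancel₀ _ hden', ← map_mul,
        ← map_add]
      rw [RatFunc.num_div_denom, mul_comm, EuclideanDomain.mod_add_div]
    rw [h, norm_div, div_lt_one (norm_pos_iff.2 hden')]
    by_cases h0 : r.num % r.denom = 0
    · rw [h0, map_zero, norm_zero]; exact norm_pos_iff.2 hden'
    · rw [norm_algebraMap_polynomial k h0, norm_algebraMap_polynomial k hden]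
      exact pow_lt_pow_right₀ (one_lt_card_real k)
        (natDegree_lt_natDegree h0 (EuclideanDomain.mod_lt _ hden))
  refine ⟨r.num / r.denom, ?_⟩
  rw [← sub_add_sub_cancel x (algebraMap (RatFunc k) (KInfty k) r)]
  exact (IsUltrametricDist.norm_add_le_max _ _).trans_lt (max_lt hr hrem)

end AbsoluteValue

/-! ### The Carlitz logarithm at `1` -/

section Logarithm

variable (k : Type*) [Field k]

theorem algebraMap_ratFunc_X : algebraMap (RatFunc k) (KInfty k) RatFunc.X = tInfty k := by
  rw [tInfty, IsScalarTower.algebraMap_apply k[X] (RatFunc k) (KInfty k), RatFunc.algebraMap_X]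

variable [Fintype k]

theorem norm_carlitzLogCoeff_le (i : ℕ) :
    ‖algebraMap (RatFunc k) (KInfty k) (carlitzLogCoeff k i)‖ ≤ ((Fintype.card k : ℝ)⁻¹) ^ i := by
  have hq := one_lt_card_real k
  induction i with
  | zero => simp [carlitzLogCoeff]
  | succ i ih =>
    have hlt : ‖tInfty k‖ < ‖tInfty k ^ Fintype.card k ^ (i + 1)‖ := by
      rw [norm_pow, norm_tInfty]
      exact lt_self_pow₀ hq (Nat.one_lt_pow (by omega) Fintype.one_lt_card)
    have h1 : (Fintype.card k : ℝ) ≤ ‖tInfty k - tInfty k ^ Fintype.card k ^ (i + 1)‖ := by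
      rw [sub_eq_add_neg, IsUltrametricDist.norm_add_eq_max_of_norm_ne_norm
        (by rw [norm_neg]; exact hlt.ne), norm_neg, max_eq_right hlt.le, ← norm_tInfty]
      exact hlt.le
    rw [carlitzLogCoeff, map_div₀, map_sub, map_pow, algebraMap_ratFunc_X, norm_div, pow_succ,
      div_eq_mul_inv]
    exact mul_le_mul ih (inv_anti₀ (one_pos.trans hq) h1) (inv_nonneg.2 (norm_nonneg _))
      (pow_nonneg (inv_nonneg.2 (Nat.cast_nonneg _)) _)

theorem carlitzLogTerm_one (i : ℕ) : carlitzLogTerm k (KInfty k) 1 i =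
    algebraMap (RatFunc k) (KInfty k) (carlitzLogCoeff k i) := by
  rw [carlitzLogTerm, one_pow, smul_eq_mul, mul_one]

theorem summable_inv_card_pow : Summable fun i : ℕ => ((Fintype.card k : ℝ)⁻¹) ^ i :=
  summable_geometric_of_lt_one (by positivity) (inv_lt_one_of_one_lt₀ (one_lt_card_real k))

theorem summable_carlitzLogTerm_one : Summable (carlitzLogTerm k (KInfty k) 1) :=
  .of_norm_bounded (summable_inv_card_pow k) fun i => by
    rw [carlitzLogTerm_one]; exact norm_carlitzLogCoeff_le k i

theorem hasSum_carlitzLogCoeff :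
    HasSum (fun i => algebraMap (RatFunc k) (KInfty k) (carlitzLogCoeff k i))
      (carlitzLog k (KInfty k) 1) := by
  have h : HasSum (carlitzLogTerm k (KInfty k) 1) (carlitzLog k (KInfty k) 1) :=
    (summable_carlitzLogTerm_one k).hasSum
  rwa [funext (carlitzLogTerm_one k)] at h

theorem norm_carlitzLog_one_sub_one_lt : ‖carlitzLog k (KInfty k) 1 - 1‖ < 1 := by
  have h := hasSum_carlitzLogCoeff k
  rw [← hasSum_nat_add_iff' 1, Finset.sum_range_one, carlitzLogCoeff, map_one] at h
  rw [← h.tsum_eq]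
  refine lt_of_le_of_lt (IsUltrametricDist.norm_tsum_le_of_forall_le_of_nonneg
    (C := (Fintype.card k : ℝ)⁻¹) (by positivity) fun i => ?_)
    (inv_lt_one_of_one_lt₀ (one_lt_card_real k))
  refine (norm_carlitzLogCoeff_le k (i + 1)).trans ?_
  exact pow_le_of_le_one (by positivity) (inv_lt_one_of_one_lt₀ (one_lt_card_real k)).le (by omega)

theorem norm_carlitzLog_one : ‖carlitzLog k (KInfty k) 1‖ = 1 := by
  have h := norm_carlitzLog_one_sub_one_lt k
  have h1 := IsUltrametricDist.norm_add_eq_max_of_norm_ne_norm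
    (x := carlitzLog k (KInfty k) 1 - 1) (y := 1) (by rw [norm_one]; exact h.ne)
  rwa [sub_add_cancel, norm_one, max_eq_right h.le] at h1

theorem carlitzLog_one_ne_zero : carlitzLog k (KInfty k) 1 ≠ 0 := by
  rw [← norm_ne_zero_iff, norm_carlitzLog_one]; exact one_ne_zero

/-- The double series `∑ e_i l_j ^ (q ^ i)` converges absolutely; its sum by rows is
`exp (log 1)`, its sum by antidiagonals is `1`. -/
theorem hasSum_carlitzExpTerm_carlitzLog_one :
    HasSum (carlitzExpTerm k (KInfty k) (carlitzLog k (KInfty k) 1)) 1 := by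
  have hq := one_lt_card_real k
  let F : ℕ × ℕ → KInfty k := fun p => algebraMap (RatFunc k) (KInfty k)
    (carlitzExpCoeff k p.1 * carlitzLogCoeff k p.2 ^ Fintype.card k ^ p.1)
  have hinv : (Fintype.card k : ℝ)⁻¹ ≤ 1 := (inv_lt_one_of_one_lt₀ hq).le
  have hF : Summable F := by
    refine .of_norm_bounded ((summable_inv_card_pow k).mul_of_nonneg (summable_inv_card_pow k)
      (fun _ => by positivity) (fun _ => by positivity)) fun p => ?_
    simp only [F]
    have hpos : Fintype.card k ^ p.1 ≠ 0 := pow_ne_zero _ Fintype.card_ne_zero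
    rw [map_mul, map_pow, norm_mul, norm_pow, norm_carlitzExpCoeff, ← inv_pow]
    gcongr ?_ * ?_
    · exact pow_le_pow_of_le_one (by positivity) hinv (Nat.le_mul_of_pos_right _ (by omega))
    · have h := norm_carlitzLogCoeff_le k p.2
      exact (pow_le_of_le_one (norm_nonneg _) (h.trans (pow_le_one₀ (by positivity) hinv))
        hpos).trans h
  have hrow (i : ℕ) : HasSum (fun j => F (i, j))
      (carlitzExpTerm k (KInfty k) (carlitzLog k (KInfty k) 1) i) := by
    have hadd (x y : KInfty k) := add_pow_card_pow k x y i
    let φ : KInfty k →+ KInfty k :=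
      { toFun := fun x => x ^ Fintype.card k ^ i
        map_zero' := zero_pow (pow_ne_zero _ Fintype.card_ne_zero)
        map_add' := hadd }
    have h : HasSum (fun j => φ (algebraMap (RatFunc k) (KInfty k) (carlitzLogCoeff k j)))
        (φ (carlitzLog k (KInfty k) 1)) :=
      (hasSum_carlitzLogCoeff k).map φ (continuous_pow _)
    have hFi : (fun j => F (i, j)) = fun j => algebraMap (RatFunc k) (KInfty k)
        (carlitzExpCoeff k i) * φ (algebraMap (RatFunc k) (KInfty k) (carlitzLogCoeff k j)) := by
      funext j
      simp only [F, map_mul, map_pow]; rfl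
    rw [hFi]
    exact h.mul_left _
  have hdiag := (Finset.HasAntidiagonal.sigmaAntidiagonalEquivProd (A := ℕ)).hasSum_iff.2 hF.hasSum
  have hdiag' := hdiag.sigma fun n => hasSum_fintype _
  have hfib (n : ℕ) : ∑ p : Finset.HasAntidiagonal.antidiagonal n,
      (F ∘ Finset.HasAntidiagonal.sigmaAntidiagonalEquivProd) ⟨n, p⟩ = if n = 0 then 1 else 0 := by
    have h := congrArg (algebraMap (RatFunc k) (KInfty k))
      (carlitzExpCoeff_comp_carlitzLogCoeff k n)
    rw [map_sum, ← Finset.sum_coe_sort] at h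
    refine Eq.trans ?_ (h.trans (by split_ifs <;> simp))
    rfl
  simp only [hfib] at hdiag'
  have h1 : ∑' p, F p = 1 := hdiag'.unique (hasSum_ite_eq 0 1)
  have hs := hF.hasSum
  rw [h1] at hs
  exact hs.prod_fiberwise hrow

theorem carlitzExp_carlitzLog_one :
    carlitzExp k (KInfty k) (carlitzLog k (KInfty k) 1) = toE k (KInfty k) 1 := by
  rw [carlitzExp_apply, (hasSum_carlitzExpTerm_carlitzLog_one k).tsum_eq]

end Logarithm

/-! ### Reciprocal sums of monic polynomials -/

section PowerSums

variable (k : Type*) [Field k] [Fintype k]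

/-- The coefficient of `z ^ (q ^ d)` in the power series `exp (x log z)`, as a polynomial in `x`.
At an element `a` of `k[t]` this is the coefficient of `z ^ (q ^ d)` in the polynomial by which `a`
acts on the Carlitz module. -/
def carlitzPoly (d : ℕ) : (RatFunc k)[X] :=
  ∑ p ∈ Finset.HasAntidiagonal.antidiagonal d,
    monomial (Fintype.card k ^ p.1)
      (carlitzExpCoeff k p.1 * carlitzLogCoeff k p.2 ^ Fintype.card k ^ p.1)

theorem eval_carlitzPoly (d : ℕ) (x : RatFunc k) : (carlitzPoly k d).eval x =
    ∑ p ∈ Finset.HasAntidiagonal.antidiagonal d,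
      carlitzExpCoeff k p.1 * carlitzLogCoeff k p.2 ^ Fintype.card k ^ p.1 *
        x ^ Fintype.card k ^ p.1 := by
  rw [carlitzPoly, eval_finsetSum]
  simp only [eval_monomial]

theorem eval_carlitzPoly_add (d : ℕ) (x y : RatFunc k) :
    (carlitzPoly k d).eval (x + y) = (carlitzPoly k d).eval x + (carlitzPoly k d).eval y := by
  simp only [eval_carlitzPoly, add_pow_card_pow, mul_add, Finset.sum_add_distrib]

theorem eval_carlitzPoly_C_mul (d : ℕ) (c : k) (x : RatFunc k) :
    (carlitzPoly k d).eval (RatFunc.C c * x) = RatFunc.C c * (carlitzPoly k d).eval x := by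
  have hc (i : ℕ) : c ^ Fintype.card k ^ i = c := FiniteField.pow_card_pow i c
  simp only [eval_carlitzPoly, mul_pow, ← map_pow, hc, Finset.mul_sum]
  exact Finset.sum_congr rfl fun p _ => by ring

theorem eval_carlitzPoly_one (d : ℕ) : (carlitzPoly k d).eval 1 = if d = 0 then 1 else 0 := by
  rw [← carlitzExpCoeff_comp_carlitzLogCoeff, eval_carlitzPoly]
  simp only [one_pow, mul_one]

/-- The coefficient of `z ^ (q ^ (d + 1))` in the functional equation
`exp (t x log z) = t exp (x log z) + exp (x log z) ^ q`. -/
theorem eval_carlitzPoly_X_mul (d : ℕ) (x : RatFunc k) :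
    (carlitzPoly k (d + 1)).eval (RatFunc.X * x) =
      RatFunc.X * (carlitzPoly k (d + 1)).eval x + (carlitzPoly k d).eval x ^ Fintype.card k := by
  have hf : (carlitzPoly k d).eval x ^ Fintype.card k =
      ∑ p ∈ Finset.HasAntidiagonal.antidiagonal d,
        (carlitzExpCoeff k p.1 * carlitzLogCoeff k p.2 ^ Fintype.card k ^ p.1 *
          x ^ Fintype.card k ^ p.1) ^ Fintype.card k := by
    rw [eval_carlitzPoly]
    exact map_sum (FiniteField.frobeniusAlgHom k (RatFunc k)) _ _
  rw [hf]
  simp only [eval_carlitzPoly, Finset.Nat.sum_antidiagonal_succ, mul_add, Finset.mul_sum]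
  rw [add_assoc, ← Finset.sum_add_distrib]
  congr 1
  · simp [carlitzExpCoeff]; ring
  · refine Finset.sum_congr rfl fun p _ => ?_
    have h := carlitzExpCoeff_spec k p.1
    simp only [mul_pow, ← pow_mul, ← pow_succ]
    linear_combination (-carlitzLogCoeff k p.2 ^ Fintype.card k ^ (p.1 + 1) *
      x ^ Fintype.card k ^ (p.1 + 1)) * h

theorem eval_carlitzPoly_X_pow (n : ℕ) :
    ∀ d, n ≤ d → (carlitzPoly k d).eval (RatFunc.X ^ n) = if d = n then 1 else 0 := by
  induction n with
  | zero => intro d _; rw [pow_zero, eval_carlitzPoly_one]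
  | succ n ih =>
    intro d hd
    obtain ⟨d, rfl⟩ : ∃ m, d = m + 1 := ⟨d - 1, by omega⟩
    rw [pow_succ', eval_carlitzPoly_X_mul, ih _ (by omega), ih _ (by omega),
      if_neg (by omega), mul_zero, zero_add]
    simp only [Nat.add_right_cancel_iff]
    split_ifs
    · exact one_pow _
    · exact zero_pow Fintype.card_ne_zero

/-- As the action of `a ∈ k[t]` on the Carlitz module has degree `q ^ deg a`, the coefficients of
higher degree vanish. -/
theorem eval_carlitzPoly_of_degree_lt (d : ℕ) {a : k[X]} (ha : a.degree < d) :
    (carlitzPoly k d).eval (algebraMap k[X] (RatFunc k) a) = 0 := by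
  let φ : RatFunc k →+ RatFunc k :=
    AddMonoidHom.mk' (fun x => (carlitzPoly k d).eval x) (eval_carlitzPoly_add k d)
  change φ _ = 0
  rw [a.as_sum_range_C_mul_X_pow, map_sum, map_sum]
  refine Finset.sum_eq_zero fun i hi => ?_
  by_cases h0 : a.coeff i = 0
  · rw [h0, C_0, zero_mul, map_zero, map_zero]
  · have hid : i < d := by
      have := (le_degree_of_ne_zero h0).trans_lt ha
      exact_mod_cast this
    rw [map_mul, map_pow, RatFunc.algebraMap_C, RatFunc.algebraMap_X]
    exact (eval_carlitzPoly_C_mul k d _ _).trans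
      (by rw [eval_carlitzPoly_X_pow k i d hid.le, if_neg hid.ne', mul_zero])

theorem derivative_carlitzPoly (d : ℕ) :
    derivative (carlitzPoly k d) = C (carlitzLogCoeff k d) := by
  have hcard : ((Fintype.card k : ℕ) : RatFunc k) = 0 := by
    rw [← map_natCast (algebraMap k (RatFunc k)), FiniteField.cast_card_eq_zero, map_zero]
  have hmon (i : ℕ) (c : RatFunc k) (hi : i ≠ 0) :
      derivative (monomial (Fintype.card k ^ i) c) = 0 := by
    rw [derivative_monomial, Nat.cast_pow, hcard, zero_pow hi, mul_zero, map_zero]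
  rw [carlitzPoly, derivative_sum]
  rw [Finset.sum_eq_single (0, d)]
  · simp [carlitzExpCoeff, derivative_monomial]
  · intro p hp hne
    refine hmon _ _ fun h => hne ?_
    rw [Finset.HasAntidiagonal.mem_antidiagonal] at hp
    exact Prod.ext h (by simpa [h] using hp)
  · intro h; simp at h

theorem carlitzExpCoeff_ne_zero (i : ℕ) : carlitzExpCoeff k i ≠ 0 := by
  intro h
  have h1 := norm_carlitzExpCoeff k i
  have hq := one_lt_card_real k
  rw [h, map_zero, norm_zero] at h1
  exact (inv_pos.2 (pow_pos (one_pos.trans hq) _)).ne h1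

theorem coeff_carlitzPoly_card_pow (d : ℕ) :
    (carlitzPoly k d).coeff (Fintype.card k ^ d) = carlitzExpCoeff k d := by
  rw [carlitzPoly, finsetSum_coeff, Finset.sum_eq_single (d, 0)]
  · simp [carlitzLogCoeff]
  · intro p hp hne
    rw [coeff_monomial, if_neg]
    intro h
    have h' : p.1 = d := Nat.pow_right_injective Fintype.one_lt_card h
    rw [Finset.HasAntidiagonal.mem_antidiagonal] at hp
    exact hne (Prod.ext h' (by simp; omega))
  · intro h; simp at h

theorem natDegree_carlitzPoly_le (d : ℕ) :
    (carlitzPoly k d).natDegree ≤ Fintype.card k ^ d := by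
  refine natDegree_sum_le_of_forall_le _ _ fun p hp => (natDegree_monomial_le _).trans ?_
  rw [Finset.HasAntidiagonal.mem_antidiagonal] at hp
  exact Nat.pow_le_pow_right Fintype.card_pos (by omega)

theorem carlitzPoly_ne_zero (d : ℕ) : carlitzPoly k d ≠ 0 := fun h =>
  carlitzExpCoeff_ne_zero k d (by rw [← coeff_carlitzPoly_card_pow, h, coeff_zero])

instance (d : ℕ) : Fintype (degreeLT k d) := Fintype.ofEquiv _ (degreeLTEquiv k d).symm.toEquiv

theorem card_degreeLT (d : ℕ) : Fintype.card (degreeLT k d) = Fintype.card k ^ d := by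
  rw [Fintype.card_congr (degreeLTEquiv k d).toEquiv, Fintype.card_fun, Fintype.card_fin]

/-- By degree, the polynomial `carlitzPoly k d` has no zeros but the `a ∈ k[t]` with
`deg a < d`. -/
theorem roots_carlitzPoly (d : ℕ) : (carlitzPoly k d).roots =
    (Finset.univ : Finset (degreeLT k d)).val.map
      fun a : degreeLT k d => algebraMap k[X] (RatFunc k) (a : k[X]) := by
  have hinj : Function.Injective fun a : degreeLT k d => algebraMap k[X] (RatFunc k) (a : k[X]) :=
    (RatFunc.algebraMap_injective k).comp Subtype.val_injective
  symm
  refine Multiset.eq_of_le_of_card_le ?_ ?_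
  · refine (Multiset.le_iff_subset (Finset.univ.nodup.map hinj)).2 fun x hx => ?_
    obtain ⟨a, -, rfl⟩ := Multiset.mem_map.1 hx
    exact (mem_roots (carlitzPoly_ne_zero k d)).2
      (eval_carlitzPoly_of_degree_lt k d (mem_degreeLT.1 a.2))
  · rw [Multiset.card_map, Finset.card_val, Finset.card_univ, card_degreeLT]
    exact (card_roots' _).trans (natDegree_carlitzPoly_le k d)

/-- Carlitz's formula for the sum of the reciprocals of the monic polynomials of degree `d`: it is
the logarithmic derivative of `carlitzPoly k d` at `t ^ d`. -/
theorem sum_inv_monic (d : ℕ) :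
    ∑ a : degreeLT k d, (algebraMap k[X] (RatFunc k) (X ^ d + (a : k[X])))⁻¹ =
      carlitzLogCoeff k d := by
  have h1 := eval_carlitzPoly_X_pow k d d le_rfl
  rw [if_pos rfl] at h1
  have hcard : (carlitzPoly k d).natDegree ≤ (carlitzPoly k d).roots.card := by
    rw [roots_carlitzPoly, Multiset.card_map, Finset.card_val, Finset.card_univ, card_degreeLT]
    exact natDegree_carlitzPoly_le k d
  have hs : (carlitzPoly k d).Splits :=
    splits_iff_card_roots.2 ((card_roots' _).antisymm hcard)
  have h := hs.eval_derivative_div_eval_of_ne_zero (x := RatFunc.X ^ d)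
    (by rw [h1]; exact one_ne_zero)
  rw [h1, div_one, derivative_carlitzPoly, eval_C, roots_carlitzPoly, Multiset.map_map] at h
  rw [h, ← Equiv.sum_comp (Equiv.neg _)]
  refine Finset.sum_congr rfl fun a _ => ?_
  simp [RatFunc.algebraMap_X, sub_eq_add_neg]

end PowerSums

/-! ### Fitting ideals of cyclic modules -/

section Fitting

theorem fittingIdeal_quotient_span_singleton {A : Type*} [CommRing A] (f : A) :
    fittingIdeal A (A ⧸ Ideal.span {f}) = Ideal.span {f} := by
  refine le_antisymm (Ideal.span_le.2 ?_) ?_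
  · rintro _ ⟨n, x, B, hx, hB, rfl⟩
    -- by Cramer's rule, the determinant annihilates the generators
    have hdet (j : Fin n) : B.det • x j = 0 := by
      have h : ∑ i, B.adjugate j i • ∑ l, B i l • x l = B.det • x j := by
        simp only [Finset.smul_sum, smul_smul]
        rw [Finset.sum_comm]
        simp only [← Finset.sum_smul, ← Matrix.mul_apply, Matrix.adjugate_mul, Matrix.smul_apply,
          Matrix.one_apply]
        simp
      rw [← h]
      simp [hB]
    have hann : ∀ m : A ⧸ Ideal.span {f}, B.det • m = 0 := by
      intro m
      have hm : m ∈ Submodule.span A (Set.range x) := hx ▸ Submodule.mem_top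
      induction hm using Submodule.span_induction with
      | mem m hm => obtain ⟨j, rfl⟩ := hm; exact hdet j
      | zero => exact smul_zero _
      | add a b _ _ ha hb => rw [smul_add, ha, hb, add_zero]
      | smul c a _ ha => rw [smul_comm, ha, smul_zero]
    have h1 := hann 1
    rw [Algebra.smul_def, mul_one] at h1
    exact Ideal.Quotient.eq_zero_iff_mem.1 h1
  · rw [Ideal.span_singleton_le_iff_mem]
    refine Ideal.subset_span ⟨1, fun _ => 1, Matrix.of fun _ _ => f, ?_, fun i => ?_, by simp⟩
    · rw [Set.range_const, eq_top_iff]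
      intro m _
      obtain ⟨a, rfl⟩ := Ideal.Quotient.mk_surjective m
      refine Submodule.mem_span_singleton.2 ⟨a, ?_⟩
      rw [Algebra.smul_def, mul_one]; rfl
    · simp only [Matrix.of_apply, Finset.univ_unique, Finset.sum_singleton, Algebra.smul_def,
        mul_one]
      exact Ideal.Quotient.eq_zero_iff_mem.2 (Ideal.mem_span_singleton_self f)

theorem fittingIdeal_of_subsingleton (A M : Type*) [CommRing A] [AddCommGroup M] [Module A M]
    [Subsingleton M] : fittingIdeal A M = ⊤ := by
  rw [Ideal.eq_top_iff_one]
  exact Ideal.subset_span ⟨0, Fin.elim0, 0, Subsingleton.elim _ _, fun i => i.elim0, by simp⟩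

variable (k : Type*) [Field k]

theorem fittingCard_eq_of_monic {M : Type*} [AddCommGroup M] [Module k[X] M] {f : k[X]}
    (hf : f.Monic) (h : fittingIdeal k[X] M = Ideal.span {f}) : fittingCard k M = f := by
  have hg : Associated (Submodule.IsPrincipal.generator (fittingIdeal k[X] M)) f := by
    rw [← Ideal.span_singleton_eq_span_singleton, ← h]
    exact Ideal.span_singleton_generator _
  have hne : Submodule.IsPrincipal.generator (fittingIdeal k[X] M) ≠ 0 :=
    hg.ne_zero_iff.2 hf.ne_zero
  have hlc := leadingCoeff_ne_zero.2 hne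
  rw [fittingCard]
  refine eq_of_monic_of_associated ?_ hf ((associated_unit_mul_left _ _ ?_).trans hg)
  · rw [mul_comm]
    exact monic_mul_leadingCoeff_inv hne
  · exact isUnit_C.2 (inv_ne_zero hlc).isUnit

theorem fittingCard_of_subsingleton (M : Type*) [AddCommGroup M] [Module k[X] M]
    [Subsingleton M] : fittingCard k M = 1 :=
  fittingCard_eq_of_monic k monic_one
    ((fittingIdeal_of_subsingleton _ _).trans Ideal.span_singleton_one.symm)

end Fitting

/-! ### The zeta value -/

section Zeta

variable (k : Type*) [Field k]

/-- The non-zero ideals of `k[t]` correspond to the monic polynomials `t ^ d + a`, `deg a < d`. -/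
def idealEquiv : (Σ d : ℕ, degreeLT k d) ≃ {I : Ideal k[X] // I ≠ ⊥} :=
  Equiv.ofBijective
    (fun p => ⟨Ideal.span {X ^ p.1 + (p.2 : k[X])}, by
      rw [Ne, Ideal.span_singleton_eq_bot]
      exact (monic_X_pow_add (mem_degreeLT.1 p.2.2)).ne_zero⟩) (by
    constructor
    · rintro ⟨d, a⟩ ⟨e, b⟩ h
      have h' : X ^ d + (a : k[X]) = X ^ e + (b : k[X]) :=
        eq_of_monic_of_associated (monic_X_pow_add (mem_degreeLT.1 a.2))
          (monic_X_pow_add (mem_degreeLT.1 b.2))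
          (Ideal.span_singleton_eq_span_singleton.1 (congrArg Subtype.val h))
      have hd {n : ℕ} (c : degreeLT k n) : (X ^ n + (c : k[X])).natDegree = n :=
        ((monicEquivDegreeLT n).symm c).2.2
      obtain rfl : d = e := by rw [← hd a, h', hd b]
      rw [Subtype.ext (add_left_cancel h')]
    · rintro ⟨I, hI⟩
      obtain ⟨g, rfl⟩ := Submodule.IsPrincipal.principal I
      rw [Ideal.submodule_span_eq] at hI
      have hg : g ≠ 0 := fun h => hI (Ideal.span_singleton_eq_bot.2 h)
      let f : {p : k[X] // p.Monic ∧ p.natDegree = g.natDegree} :=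
        ⟨g * C g.leadingCoeff⁻¹, monic_mul_leadingCoeff_inv hg,
          natDegree_mul_leadingCoeff_inv g hg⟩
      refine ⟨⟨_, monicEquivDegreeLT _ f⟩, Subtype.ext ?_⟩
      have hf : X ^ g.natDegree + (monicEquivDegreeLT _ f : k[X]) = f.1 :=
        congrArg Subtype.val ((monicEquivDegreeLT _).symm_apply_apply f)
      change Ideal.span {X ^ g.natDegree + (monicEquivDegreeLT _ f : k[X])} = _
      rw [hf]
      exact Ideal.span_singleton_eq_span_singleton.2 (associated_mul_unit_left _ _
        (isUnit_C.2 (inv_ne_zero (leadingCoeff_ne_zero.2 hg)).isUnit)))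

theorem zetaTerm_idealEquiv (p : Σ d : ℕ, degreeLT k d) :
    zetaTerm k k[X] (idealEquiv k p) =
      (algebraMap k[X] (KInfty k) (X ^ p.1 + (p.2 : k[X])))⁻¹ := by
  rw [zetaTerm]
  congr 2
  exact fittingCard_eq_of_monic k (monic_X_pow_add (mem_degreeLT.1 p.2.2))
    (fittingIdeal_quotient_span_singleton _)

variable [Fintype k]

theorem norm_zetaTerm_idealEquiv (p : Σ d : ℕ, degreeLT k d) :
    ‖zetaTerm k k[X] (idealEquiv k p)‖ = ((Fintype.card k : ℝ)⁻¹) ^ p.1 := by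
  have hm := monic_X_pow_add (mem_degreeLT.1 p.2.2)
  have hd : (X ^ p.1 + (p.2 : k[X])).natDegree = p.1 := ((monicEquivDegreeLT p.1).symm p.2).2.2
  rw [zetaTerm_idealEquiv, norm_inv, norm_algebraMap_polynomial k hm.ne_zero, hd, inv_pow]

/-- The terms tend to zero, which suffices for a non-archimedean absolute value; the series of
absolute values diverges. -/
theorem summable_zetaTerm_idealEquiv :
    Summable fun p => zetaTerm k k[X] (idealEquiv k p) := by
  refine NonarchimedeanAddGroup.summable_of_tendsto_cofinite_zero ?_
  rw [tendsto_zero_iff_norm_tendsto_zero]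
  simp only [norm_zetaTerm_idealEquiv]
  have h1 : Filter.Tendsto (fun n : ℕ => ((Fintype.card k : ℝ)⁻¹) ^ n) Filter.cofinite
      (nhds 0) := by
    rw [Nat.cofinite_eq_atTop]
    exact (summable_inv_card_pow k).tendsto_atTop_zero
  refine h1.comp (Filter.Tendsto.cofinite_of_finite_preimage_singleton fun n => ?_)
  refine (Set.finite_range fun a : degreeLT k n => (⟨n, a⟩ : Σ d : ℕ, degreeLT k d)).subset ?_
  rintro ⟨m, a⟩ rfl
  exact ⟨a, rfl⟩

theorem summable_zetaTerm :
    Summable fun I : {I : Ideal k[X] // I ≠ ⊥} => zetaTerm k k[X] I :=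
  (idealEquiv k).summable_iff.1 (summable_zetaTerm_idealEquiv k)

theorem zetaOne_eq_carlitzLog_one : zetaOne k k[X] = carlitzLog k (KInfty k) 1 := by
  have h := (summable_zetaTerm_idealEquiv k).hasSum.sigma fun d => hasSum_fintype _
  have hd (d : ℕ) : ∑ a : degreeLT k d, zetaTerm k k[X] (idealEquiv k ⟨d, a⟩) =
      algebraMap (RatFunc k) (KInfty k) (carlitzLogCoeff k d) := by
    simp only [zetaTerm_idealEquiv, ← sum_inv_monic, map_sum, map_inv₀,
      ← IsScalarTower.algebraMap_apply]
  simp only [hd] at h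
  exact ((idealEquiv k).tsum_eq fun I => zetaTerm k k[X] I).symm.trans
    (h.unique (hasSum_carlitzLogCoeff k))

end Zeta

end Carlitz

/-! ### Additive Hilbert 90 for locally constant cocycles -/

/-- For a cocycle that vanishes on `Gal(L/E)`, where `E` is finite and Galois over `K`, the negative
of `∑ f s * s b` over `s ∈ Gal(E/K)` is a solution as soon as `b ∈ E` has trace `1`. -/
theorem exists_eq_galois_sub_self {K L : Type*} [Field K] [Field L] [Algebra K L] [IsGalois K L]
    (f : Gal(L/K) → L) (hf : ∀ σ τ, f (σ * τ) = f σ + σ (f τ))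
    (h0 : ∀ᶠ σ in nhds 1, f σ = 0) : ∃ y : L, ∀ σ, f σ = σ y - y := by
  obtain ⟨F, hfd, hn, hF⟩ := (krullTopology_mem_nhds_one_iff_of_normal K L _).1 h0
  have hsep : Algebra.IsSeparable K F := Algebra.isSeparable_tower_bot_of_isSeparable K F L
  have hgal : IsGalois K F := ⟨⟩
  obtain ⟨b, hb⟩ := Algebra.trace_surjective K F 1
  have htr : ∑ s : Gal(F/K), ((s b : F) : L) = 1 := by
    have h := trace_eq_sum_automorphisms (K := K) b
    rw [hb, map_one] at h
    rw [← AddSubmonoidClass.coe_finsetSum, ← h]; rfl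
  let π : Gal(L/K) →* Gal(F/K) := AlgEquiv.restrictNormalHom F
  have hπ (σ : Gal(L/K)) (x : F) : ((π σ x : F) : L) = σ x := AlgEquiv.restrictNormal_commutes σ F x
  obtain ⟨s, hs⟩ := (AlgEquiv.restrictNormalHom_surjective (F := K) (K₁ := F) L).hasRightInverse
  let g : Gal(F/K) → L := fun τ => f (s τ)
  have hg (σ : Gal(L/K)) : f σ = g (π σ) := by
    have hker : (s (π σ))⁻¹ * σ ∈ F.fixingSubgroup := by
      rw [← IntermediateField.restrictNormalHom_ker, MonoidHom.mem_ker, map_mul, map_inv, hs,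
        inv_mul_cancel]
    have h := hf (s (π σ)) ((s (π σ))⁻¹ * σ)
    rw [show f ((s (π σ))⁻¹ * σ) = 0 from hF hker, map_zero, add_zero, mul_inv_cancel_left] at h
    exact h
  refine ⟨-∑ τ : Gal(F/K), g τ * ((τ b : F) : L), fun σ => ?_⟩
  have hσ : σ (∑ τ : Gal(F/K), g τ * ((τ b : F) : L)) =
      ∑ τ : Gal(F/K), g τ * ((τ b : F) : L) - f σ := by
    calc σ (∑ τ : Gal(F/K), g τ * ((τ b : F) : L))
        = ∑ τ : Gal(F/K), (g (π σ * τ) * (((π σ * τ) b : F) : L) -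
            f σ * (((π σ * τ) b : F) : L)) := by
          rw [map_sum]
          refine Finset.sum_congr rfl fun τ _ => ?_
          have h1 : g (π σ * τ) = f σ + σ (g τ) := by
            rw [← hf, hg, map_mul]
            congr 2
            exact (hs τ).symm
          rw [map_mul, h1, AlgEquiv.mul_apply, hπ]
          ring
      _ = _ := by
          refine (Equiv.sum_comp (Equiv.mulLeft (π σ))
            fun τ : Gal(F/K) => g τ * ((τ b : F) : L) - f σ * ((τ b : F) : L)).trans ?_
          rw [Finset.sum_sub_distrib, ← Finset.mul_sum, htr, mul_one]
  rw [map_neg, hσ]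
  ring

namespace Carlitz

/-! ### The exponential near zero -/

section SmallExp

variable (k : Type*) [Field k] [Fintype k]
variable (L : Type*) [NormedField L] [NormedAlgebra (KInfty k) L] [IsUltrametricDist L]
  [Algebra.IsAlgebraic (KInfty k) L]

theorem norm_tsum_carlitzExpTerm {y : L} (hy : ‖y‖ ≤ Fintype.card k) :
    ‖∑' i, carlitzExpTerm k L y i‖ = ‖y‖ := by
  rcases eq_or_ne y 0 with rfl | h0
  · simpa using norm_tsum_carlitzExpTerm_sub_le k L 0 (by simp)
  · have hlt : ‖∑' i, carlitzExpTerm k L y i - y‖ < ‖y‖ :=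
      (norm_tsum_carlitzExpTerm_sub_le k L y hy).trans_lt
        (div_lt_self (norm_pos_iff.2 h0) (one_lt_card_real k))
    have h := IsUltrametricDist.norm_add_eq_max_of_norm_ne_norm hlt.ne
    rwa [sub_add_cancel, max_eq_right hlt.le] at h

theorem eq_zero_of_tsum_carlitzExpTerm_eq_zero {y : L} (hy : ‖y‖ ≤ Fintype.card k)
    (h : ∑' i, carlitzExpTerm k L y i = 0) : y = 0 := by
  rw [← norm_eq_zero, ← norm_tsum_carlitzExpTerm k L hy, h, norm_zero]

end SmallExp

/-! ### The connecting homomorphism -/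

section Surjectivity

variable (k : Type*) [Field k] [Fintype k]

/-- The period lattice is discrete, so continuous cocycles with values in it are locally
constant. -/
theorem eventually_cocycle_eq_zero (f : contCocycles k[X] (G k) (Lam k)) :
    ∀ᶠ σ in nhds (1 : G k), (((f : G k → Lam k) σ : Lam k) : KSep k) = 0 := by
  have h1 : (f : G k → Lam k) 1 = 0 := by
    have h := f.2.2 1 1
    rwa [one_mul, one_smul, left_eq_add] at h
  have hc : Continuous fun σ : G k => ‖(((f : G k → Lam k) σ : Lam k) : KSep k)‖ :=
    (continuous_subtype_val.comp f.2.1).norm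
  have hlt := hc.continuousAt.eventually_lt (x₀ := 1) continuousAt_const
    (g := fun _ => (Fintype.card k : ℝ)) (by
      rw [h1, Submodule.coe_zero, norm_zero]; exact one_pos.trans (one_lt_card_real k))
  filter_upwards [hlt] with σ hσ
  exact eq_zero_of_tsum_carlitzExpTerm_eq_zero k (KSep k) hσ.le
    ((mem_Lam k).1 ((f : G k → Lam k) σ).2)

theorem connecting_surjective : Function.Surjective (connecting k) := by
  intro c
  obtain ⟨f, rfl⟩ := H1mk_surjective k[X] (G k) (Lam k) c
  obtain ⟨y, hy⟩ := exists_eq_galois_sub_self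
    (fun σ : G k => (((f : G k → Lam k) σ : Lam k) : KSep k))
    (fun σ τ => by
      rw [f.2.2 σ τ, Submodule.coe_add, coe_galois_smul_Lam]) (eventually_cocycle_eq_zero k f)
  have hfix (σ : G k) : σ (∑' i, carlitzExpTerm k (KSep k) y i) =
      ∑' i, carlitzExpTerm k (KSep k) y i := by
    have h : carlitzExp k (KSep k) (σ y - y) = 0 := by
      rw [← hy]
      exact ((f : G k → Lam k) σ).2
    rw [map_sub, sub_eq_zero, carlitzExp_apply, carlitzExp_apply, tsum_carlitzExpTerm_galois] at h
    exact (toE k (KSep k)).injective h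
  obtain ⟨x, hx⟩ := IntermediateField.mem_bot.1 ((InfiniteGalois.mem_bot_iff_fixed _).2 hfix)
  have hyx : carlitzExp k (KSep k) y = embE k (toE k (KInfty k) x) := by
    rw [carlitzExp_apply, mapE_toE, ← hx]; rfl
  refine ⟨toE k (KInfty k) x, ?_⟩
  rw [connecting_eq k _ ⟨y, _, hyx.symm⟩ hyx]
  refine congrArg (H1mk k[X] (G k) (Lam k)) (Subtype.ext (funext fun σ => Subtype.ext ?_))
  exact (hy σ).symm

theorem tsum_carlitzExpTerm_algebraMap (z : KInfty k) :
    ∑' i, carlitzExpTerm k (KSep k) (algebraMap (KInfty k) (KSep k) z) i =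
      algebraMap (KInfty k) (KSep k) (∑' i, carlitzExpTerm k (KInfty k) z i) := by
  have h := (hasSum_carlitzExpTerm k (KInfty k) z).map (algebraMap (KInfty k) (KSep k))
    (continuous_algebraMap (KInfty k) (KSep k))
  rw [← h.tsum_eq]
  congr 1
  funext i
  simp only [Function.comp_apply, carlitzExpTerm]
  rw [smul_eq_mul, map_mul, map_pow, Algebra.smul_def]

theorem connecting_carlitzExp (z : KInfty k) :
    connecting k (carlitzExp k (KInfty k) z) = 0 := by
  have hz : carlitzExp k (KSep k) (algebraMap (KInfty k) (KSep k) z) =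
      embE k (carlitzExp k (KInfty k) z) := by
    rw [carlitzExp_apply, carlitzExp_apply, mapE_toE, tsum_carlitzExpTerm_algebraMap]; rfl
  rw [connecting_eq k _ ⟨algebraMap (KInfty k) (KSep k) z, _, hz.symm⟩ hz]
  refine (H1mk_eq_zero _ _ _).2 ⟨0, fun σ => Subtype.ext ?_⟩
  rw [smul_zero, sub_zero]
  change σ (algebraMap (KInfty k) (KSep k) z) - algebraMap (KInfty k) (KSep k) z = 0
  rw [σ.commutes, sub_self]

/-- Every element of `k((t⁻¹))` is the sum of a polynomial and an element of absolute value less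
than `1`, and the latter is an exponential. -/
theorem pointsToH1_surjective : Function.Surjective (pointsToH1 k) := by
  intro c
  obtain ⟨x, rfl⟩ := connecting_surjective k c
  obtain ⟨x, rfl⟩ := (toE k (KInfty k)).surjective x
  obtain ⟨p, hp⟩ := exists_polynomial_norm_sub_lt_one k x
  obtain ⟨z, hz⟩ := exists_tsum_carlitzExpTerm_eq k (KInfty k) (x - algebraMap k[X] (KInfty k) p)
    (hp.le.trans (one_lt_card_real k).le)
  refine ⟨toE k k[X] p, ?_⟩
  have hx : toE k (KInfty k) x = pointsE k (toE k k[X] p) + carlitzExp k (KInfty k) z := by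
    rw [carlitzExp_apply, hz, pointsE, mapE_toE, ← map_add]
    congr 1
    exact (add_sub_cancel (algebraMap k[X] (KInfty k) p) x).symm
  rw [hx, map_add, connecting_carlitzExp, add_zero]
  rfl

theorem subsingleton_HR : Subsingleton (HR k) :=
  Submodule.Quotient.subsingleton_iff.2
    (LinearMap.range_eq_top.2 (pointsToH1_surjective k))

end Surjectivity

/-! ### The regulator -/

section Regulator

variable (k : Type*) [Field k] [Fintype k]

theorem carlitzLog_one_mem_expInv : carlitzLog k (KInfty k) 1 ∈ expInv k := by
  refine ⟨toE k k[X] 1, ?_⟩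
  rw [carlitzExp_carlitzLog_one, pointsE, mapE_toE, map_one]

/-- As `log 1` is a unit of absolute value `1`, every element of `k((t⁻¹))` is congruent to a
multiple of it modulo elements of absolute value less than `1`. On the latter `exp` is isometric,
so that no value there other than `0` is in `k[t]`. -/
theorem expInv_eq_span : expInv k = Submodule.span k[X] {carlitzLog k (KInfty k) 1} := by
  refine le_antisymm (fun x hx => ?_)
    ((Submodule.span_singleton_le_iff_mem _ _).2 (carlitzLog_one_mem_expInv k))
  set u := carlitzLog k (KInfty k) 1 with hu
  have hu0 : u ≠ 0 := carlitzLog_one_ne_zero k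
  obtain ⟨p, hp⟩ := exists_polynomial_norm_sub_lt_one k (x / u)
  have hr : ‖x - p • u‖ < 1 := by
    rw [← div_one ‖x - p • u‖, ← norm_carlitzLog_one k, ← hu, ← norm_div, sub_div,
      Algebra.smul_def, mul_div_cancel_right₀ _ hu0, norm_carlitzLog_one]
    exact hp
  have hrq := hr.le.trans (one_lt_card_real k).le
  obtain ⟨a, ha⟩ := (expInv k).sub_mem hx ((expInv k).smul_mem p (carlitzLog_one_mem_expInv k))
  obtain ⟨a, rfl⟩ := (toE k k[X]).surjective a
  have ha' : algebraMap k[X] (KInfty k) a =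
      ∑' i, carlitzExpTerm k (KInfty k) (x - p • u) i := by
    rw [pointsE, mapE_toE, carlitzExp_apply] at ha
    exact (toE k (KInfty k)).injective ha
  have ha0 : a = 0 := by
    by_contra h
    have h1 := one_le_norm_algebraMap_polynomial k h
    rw [ha', norm_tsum_carlitzExpTerm k (KInfty k) hrq] at h1
    exact absurd hr h1.not_gt
  rw [ha0, map_zero] at ha'
  have h0 := eq_zero_of_tsum_carlitzExpTerm_eq_zero k (KInfty k) hrq ha'.symm
  exact Submodule.mem_span_singleton.2 ⟨p, (sub_eq_zero.1 h0).symm⟩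

theorem exists_smul_carlitzLog_one (x : expInv k) :
    ∃ p : k[X], x = p • (⟨_, carlitzLog_one_mem_expInv k⟩ : expInv k) := by
  obtain ⟨p, hp⟩ := Submodule.mem_span_singleton.1 ((expInv_eq_span k).le x.2)
  exact ⟨p, Subtype.ext hp.symm⟩

theorem smul_carlitzLog_one_injective :
    Function.Injective fun p : k[X] => p • carlitzLog k (KInfty k) 1 := by
  intro p q h
  simp only [Algebra.smul_def] at h
  exact algebraMap_polynomial_injective k (mul_right_cancel₀ (carlitzLog_one_ne_zero k) h)

theorem rho_tmul (a : KInfty k) (x : expInv k) :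
    rho k (a ⊗ₜ x) = (a * (x : KInfty k)) ⊗ₜ 1 := by
  rw [rho, LinearMap.comp_apply, LinearMap.liftBaseChange_tmul]
  rfl

theorem rho_bijective : Function.Bijective (rho k) := by
  let u : expInv k := ⟨_, carlitzLog_one_mem_expInv k⟩
  have hu0 : (u : KInfty k) ≠ 0 := carlitzLog_one_ne_zero k
  have htmul (z : KInfty k ⊗[k[X]] expInv k) : ∃ a : KInfty k, z = a ⊗ₜ u := by
    induction z with
    | zero => exact ⟨0, (TensorProduct.zero_tmul _ _).symm⟩
    | tmul a x =>
      obtain ⟨p, rfl⟩ := exists_smul_carlitzLog_one k x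
      exact ⟨p • a, by rw [TensorProduct.smul_tmul]⟩
    | add x y hx hy =>
      obtain ⟨a, rfl⟩ := hx
      obtain ⟨b, rfl⟩ := hy
      exact ⟨a + b, (TensorProduct.add_tmul _ _ _).symm⟩
  have hrid (a : KInfty k) : a ⊗ₜ[k[X]] (1 : k[X]) =
      (TensorProduct.AlgebraTensorModule.rid k[X] (KInfty k) (KInfty k)).symm a := rfl
  constructor
  · rw [injective_iff_map_eq_zero]
    intro z hz
    obtain ⟨a, rfl⟩ := htmul z
    rw [rho_tmul, hrid, LinearEquiv.map_eq_zero_iff] at hz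
    rw [(mul_eq_zero.1 hz).resolve_right hu0, TensorProduct.zero_tmul]
  · intro w
    obtain ⟨a, rfl⟩ :=
      (TensorProduct.AlgebraTensorModule.rid k[X] (KInfty k) (KInfty k)).symm.surjective w
    exact ⟨(a / u) ⊗ₜ u, by rw [rho_tmul, div_mul_cancel₀ _ hu0, hrid]⟩

/-- Both modules have rank `1`; any two basis vectors differ from `log 1`, respectively from `1`,
by units. -/
theorem exists_unit_det_rho {n : ℕ} (b : Module.Basis (Fin n) k[X] (expInv k))
    (c : Module.Basis (Fin n) k[X] k[X]) : ∃ u : k[X]ˣ,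
    (LinearMap.toMatrix (b.baseChange (KInfty k)) (c.baseChange (KInfty k)) (rho k)).det =
      algebraMap k[X] (KInfty k) u * carlitzLog k (KInfty k) 1 := by
  obtain rfl : n = 1 := by
    have h := Module.finrank_eq_card_basis c
    rwa [Module.finrank_self, Fintype.card_fin, eq_comm] at h
  obtain ⟨v, hv⟩ := exists_smul_carlitzLog_one k (b 0)
  have hvu : IsUnit v := by
    have hw := b.sum_repr ⟨_, carlitzLog_one_mem_expInv k⟩
    rw [Fin.sum_univ_one, hv, smul_smul] at hw
    refine IsUnit.of_mul_eq_one_right (b.repr ⟨_, carlitzLog_one_mem_expInv k⟩ 0)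
      (smul_carlitzLog_one_injective k ?_)
    exact (congrArg Subtype.val hw).trans (one_smul _ _).symm
  have hcu : IsUnit (c.repr 1 0) := by
    have h := c.sum_repr 1
    rw [Fin.sum_univ_one, smul_eq_mul] at h
    exact IsUnit.of_mul_eq_one _ h
  refine ⟨hcu.unit * hvu.unit, ?_⟩
  rw [Matrix.det_fin_one, LinearMap.toMatrix_apply, Module.Basis.baseChange_apply, rho_tmul,
    Module.Basis.baseChange_repr_tmul, one_mul, hv]
  rw [Units.val_mul, IsUnit.unit_spec, IsUnit.unit_spec, map_mul, Algebra.smul_def, mul_assoc]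
  congr 1
  exact Algebra.smul_def _ _

theorem norm_lt_norm_iff {x y : KInfty k} : ‖x‖ < ‖y‖ ↔ Valued.v x < Valued.v y := by
  rw [norm_eq, norm_eq, NNReal.coe_lt_coe]
  exact (WithZeroMulInt.toNNReal_strictMono (one_lt_card_nnreal k)).lt_iff_lt

theorem isMonic_carlitzLog_one : IsMonic k (carlitzLog k (KInfty k) 1) := by
  refine ⟨0, ?_⟩
  rw [zpow_zero, ← norm_lt_norm_iff, norm_one]
  exact norm_carlitzLog_one_sub_one_lt k

theorem isRegulator_carlitzLog_one : IsRegulator k (carlitzLog k (KInfty k) 1) := by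
  let e : k[X] ≃ₗ[k[X]] expInv k :=
    LinearEquiv.ofBijective (LinearMap.toSpanSingleton k[X] (expInv k)
      ⟨_, carlitzLog_one_mem_expInv k⟩)
      ⟨fun p q h => smul_carlitzLog_one_injective k (congrArg Subtype.val h), fun x => by
        obtain ⟨p, rfl⟩ := exists_smul_carlitzLog_one k x
        exact ⟨p, rfl⟩⟩
  let c : Module.Basis (Fin 1) k[X] k[X] := Module.Basis.singleton (Fin 1) k[X]
  obtain ⟨u, hu⟩ := exists_unit_det_rho k (c.map e) c
  refine ⟨isMonic_carlitzLog_one k, 1, c.map e, c, u⁻¹, ?_⟩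
  rw [hu, ← mul_assoc, ← map_mul, Units.inv_mul, map_one, one_mul]

/-- A constant multiple of `log 1` with leading coefficient `1` is `log 1`. -/
theorem IsRegulator.eq_carlitzLog_one {r : KInfty k} (hr : IsRegulator k r) :
    r = carlitzLog k (KInfty k) 1 := by
  obtain ⟨⟨m, hm⟩, n, b, c, u, hu⟩ := hr
  obtain ⟨v, hv⟩ := exists_unit_det_rho k b c
  rw [hv, ← mul_assoc, ← map_mul, ← Units.val_mul] at hu
  obtain ⟨a, ha, hau⟩ := Polynomial.isUnit_iff.1 (u * v).isUnit
  rw [← hau] at hu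
  have ha0 : (C a : k[X]) ≠ 0 := C_ne_zero.2 ha.ne_zero
  have hna : ‖algebraMap k[X] (KInfty k) (C a)‖ = 1 := by
    rw [norm_algebraMap_polynomial k ha0, natDegree_C, pow_zero]
  have hnr : ‖r‖ = 1 := by rw [hu, norm_mul, hna, norm_carlitzLog_one, one_mul]
  rw [← norm_lt_norm_iff] at hm
  have hm1 : ‖tInfty k ^ m‖ = 1 := by
    have h := IsUltrametricDist.norm_add_eq_max_of_norm_ne_norm hm.ne
    rw [sub_add_cancel, hnr, max_eq_right hm.le] at h
    exact h.symm
  have hm0 : m = 0 := by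
    rw [norm_zpow, norm_tInfty] at hm1
    exact zpow_right_injective₀ (one_pos.trans (one_lt_card_real k)) (one_lt_card_real k).ne'
      (hm1.trans (zpow_zero _).symm)
  rw [hm0, zpow_zero, norm_one] at hm
  have hlt : ‖algebraMap k[X] (KInfty k) (1 - C a)‖ < 1 := by
    have h1 : algebraMap k[X] (KInfty k) (1 - C a) =
        algebraMap k[X] (KInfty k) (C a) * (carlitzLog k (KInfty k) 1 - 1) - (r - 1) := by
      rw [hu, map_sub, map_one]; ring
    have h2 : ‖algebraMap k[X] (KInfty k) (C a) * (carlitzLog k (KInfty k) 1 - 1)‖ < 1 := by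
      rw [norm_mul, hna, one_mul]
      exact norm_carlitzLog_one_sub_one_lt k
    rw [h1, sub_eq_add_neg]
    exact (IsUltrametricDist.norm_add_le_max _ _).trans_lt
      (max_lt h2 ((norm_neg _).trans_lt hm))
  have ha1 : 1 - C a = 0 := by
    by_contra h
    exact absurd hlt (one_le_norm_algebraMap_polynomial k h).not_gt
  rw [hu, ← sub_eq_zero.1 ha1, map_one, one_mul]

theorem isRegulator_Reg : IsRegulator k (Reg k) :=
  Classical.epsilon_spec ⟨_, isRegulator_carlitzLog_one k⟩

end Regulator

end Carlitz

end

theorem mainTheorem5 (k : Type*) [Field k] [Fintype k] :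
    -- the series `log(1)` converges, and `log(1)` generates `exp⁻¹(E(k[t]))`
    Summable (Carlitz.carlitzLogTerm k (Carlitz.KInfty k) 1) ∧
    Carlitz.expInv k = Submodule.span k[X] {Carlitz.carlitzLog k (Carlitz.KInfty k) 1} ∧
    -- `E(k[t]) → H¹(G, Λ_E)` is surjective
    Function.Surjective (Carlitz.pointsToH1 k) ∧
    -- the regulator, `|H_R|` and `ζ_R(1)` are well-defined
    Function.Bijective (Carlitz.rho k) ∧
    (∃! r, Carlitz.IsRegulator k r) ∧ Carlitz.IsRegulator k (Carlitz.Reg k) ∧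
    Finite (Carlitz.HR k) ∧
    Summable (fun I : {I : Ideal k[X] // I ≠ ⊥} => Carlitz.zetaTerm k k[X] I) ∧
    -- the class number formula `ζ_R(1) = Reg_R · |H_R|` and the identity `ζ_R(1) = log(1)`
    Carlitz.zetaOne k k[X] =
      Carlitz.Reg k * algebraMap k[X] (Carlitz.KInfty k) (Carlitz.fittingCard k (Carlitz.HR k)) ∧
    Carlitz.zetaOne k k[X] = Carlitz.carlitzLog k (Carlitz.KInfty k) 1 := by
  have hHR := Carlitz.subsingleton_HR k
  have hReg := Carlitz.isRegulator_Reg k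
  refine ⟨Carlitz.summable_carlitzLogTerm_one k, Carlitz.expInv_eq_span k,
    Carlitz.pointsToH1_surjective k, Carlitz.rho_bijective k,
    ⟨_, hReg, fun r hr => hr.eq_carlitzLog_one.trans hReg.eq_carlitzLog_one.symm⟩, hReg,
    inferInstance, Carlitz.summable_zetaTerm k, ?_, Carlitz.zetaOne_eq_carlitzLog_one k⟩
  rw [Carlitz.fittingCard_of_subsingleton, map_one, mul_one, hReg.eq_carlitzLog_one,
    Carlitz.zetaOne_eq_carlitzLog_one]
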